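/- Let $\mathcal C$ be a cocomplete (locally small) category and $J=\{f_i\colon A_i\to B_i\}_{i\in I}$ a (small) set of maps of $\mathcal C$. A natural weak factorisation system (n.w.f.s.) $N=(\mathsf L,\mathsf R,\Delta)$ on $\mathcal C$ is a functorial factorisation $f=\rho_f\cdot\lambda_f$ through $Ef$, with $L f=\lambda_f$ and $R f=\rho_f$, together with an extension of $(L,(1,\rho_f))$ to a comonad $\mathsf L$ on the arrow category with comultiplication $(1,\sigma_f)$ and an extension of $(R,(\lambda_f,1))$ to a monad $\mathsf R$ with multiplication $(\pi_f,1)$, such that $\Delta=(\sigma,\pi)\colon LR\Rightarrow RL$ is a distributive law. $\mathsf L$-maps are $\mathsf L$-coalgebras, i.e. maps $f\colon X\to Y$ with $s\colon Y\to Ef$ such that $sf=\lambda_f$, $\rho_f s=1$, $\sigma_f s=E(1,s)s$; $\mathsf R$-maps are $\mathsf R$-algebras. $\mathsf L$-maps $(f,s)\colon X\to Y$, $(g,t)\colon Y\to Z$ have the composite $(gf,\ \pi_{gf}\cdot E(E(1,g),1)\cdot E(s,1)\cdot t)$, and $\mathcal C_{\mathsf L}$ denotes the resulting category with the objects of $\mathcal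 C$ and with $\mathsf L$-maps as morphisms. Let $N$ be an n.w.f.s. on $\mathcal C$ and let $\alpha_i$ ($i\in I$) be $\mathsf L$-map structures on the generating cofibrations $f_i$ such that one of the following holds. (a) $N$ is generated by $J$: there is a comonad morphism $\chi\colon\mathsf L^1\to\mathsf L$ over $\mathrm{dom}$ from the one-step comonad of $J$ (where $\lambda^1_g$ is the pushout, along the canonical map to the domain of $g$, of the coproduct of the $f_x$ over all lifting problems $x\colon f_x\to g$ with $f_x\in J$) such that every comonad morphism over $\mathrm{dom}$ from $\mathsf L^1$ to the comonad $\mathsf L'$ of an n.w.f.s. $N'$ factors through $\chi$ by a unique morphism of n.w.f.s.'s $N\to N'$ (that is, $N$ is the free monoid on the pointed comonad $\mathsf L^1$); and $\alpha_i$ is the image under $\chi$ of the canonical $\mathsf L^1$-map structure on $f_i$. (b) $N$ is cofibrantly generated by $(J,\alpha)$: the functor over the arrow category sending an $\mathsf R$-map to its underlying map equipped with the right lifting data with respect to $J$ determined by $\alpha$ is an isomorphism from the category of $\mathsf R$-maps to the category of maps equipped with right lifting data. Then: (1) Every retract equaliser of a transfinite composition of pushouts of coproducts of generating cofibrations is an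 $\mathsf L$-map. In detail, let $g\colon X\to Y$ be exhibited as the transfinite composite of a smooth chain (with colimits at limit stages) whose successor maps are exhibited as pushouts of coproducts of members of $J$. Then $g$ has exactly one $\mathsf L$-map structure $s$ making $(g,s)$ the corresponding transfinite composite, in $\mathcal C_{\mathsf L}$, of pushouts of coproducts, formed in $\mathsf L$-maps, of the $(f_i,\alpha_i)$. Moreover, whenever $f\xrightarrow{i} g\rightrightarrows^{j}_{k} h$ is a contractible equaliser in the arrow category, with $p\colon g\to f$, $q\colon h\to g$ such that $pi=1$, $qj=1$, $ji=ki$, $qk=ip$, and $j,k$ are morphisms of $\mathsf L$-maps $(g,s)\to(h,t)$ for some $\mathsf L$-map structure $t$ on $h$, then $r=E(p)\cdot s\cdot\mathrm{cod}(i)$ is an $\mathsf L$-map structure on $f$, and $i\colon(f,r)\to(g,s)$ is a morphism of $\mathsf L$-maps. (2) Suppose that the domains of the members of $J$ are small: either each $\mathcal C(A_i,-)$ preserves, for some cardinal $\kappa_i$, colimits of chains indexed by $\kappa_i$-filtered ordinals; or there is an orthogonal factorisation system $(\mathcal E,\mathcal M)$ on $\mathcal C$, each object being the domain of only a set of $\mathcal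 E$-maps up to isomorphism, such that each $\mathcal C(A_i,-)$ preserves, for some cardinal $\kappa_i$, colimits of chains of $\mathcal M$-maps indexed by $\kappa_i$-filtered ordinals. (A limit ordinal $\beta$ is $\kappa$-filtered if every subset of $\beta$ of cardinality at most $\kappa$ has supremum $<\beta$.) Then the underlying map in $\mathcal C$ of every $\mathsf L$-map is a retract, in the arrow category, of a transfinite composition of pushouts of coproducts of members of $J$. -/

import Mathlib

open CategoryTheory CategoryTheory.Limits

universe w u

namespace NatWFS

variable {C : Type u} [Category.{w} C]

/-! ### Functorial factorisations, comonads over `dom`, natural weak factorisation systems -/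

variable (C) in
/-- A functorial factorisation `f = ρ_f ∘ λ_f` through `E f`. -/
structure FunFact where
  /-- the functor `E : Ar C ⥤ C` -/
  E : Arrow C ⥤ C
  /-- `λ : dom ⟶ E` -/
  lam (f : Arrow C) : f.left ⟶ E.obj f
  /-- `ρ : E ⟶ cod` -/
  rho (f : Arrow C) : E.obj f ⟶ f.right
  lam_naturality {f g : Arrow C} (φ : f ⟶ g) : φ.left ≫ lam g = lam f ≫ E.map φ
  rho_naturality {f g : Arrow C} (φ : f ⟶ g) : E.map φ ≫ rho g = rho f ≫ φ.right
  fac (f : Arrow C) : lam f ≫ rho f = f.hom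

namespace FunFact

variable (F : FunFact C)

/-- The functor `L : Ar C ⥤ Ar C` sending `f` to `λ_f`. -/
abbrev L : Arrow C ⥤ Arrow C where
  obj f := Arrow.mk (F.lam f)
  map φ := Arrow.homMk φ.left (F.E.map φ) (F.lam_naturality φ)

/-- The functor `R : Ar C ⥤ Ar C` sending `f` to `ρ_f`. -/
abbrev R : Arrow C ⥤ Arrow C where
  obj f := Arrow.mk (F.rho f)
  map φ := Arrow.homMk (F.E.map φ) φ.right (F.rho_naturality φ)

/-- The counit `Φ_f = (1, ρ_f) : L f ⟶ f`. -/
abbrev counit (f : Arrow C) : F.L.obj f ⟶ f :=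
  Arrow.homMk (𝟙 f.left) (F.rho f) ((Category.id_comp f.hom).trans (F.fac f).symm)

/-- The unit `Λ_f = (λ_f, 1) : f ⟶ R f`. -/
abbrev unit (f : Arrow C) : f ⟶ F.R.obj f :=
  Arrow.homMk (F.lam f) (𝟙 f.right) ((F.fac f).trans (Category.comp_id f.hom).symm)

end FunFact

variable (C) in
/-- A comonad `(L, Φ, Σ)` over `dom`, given by its functorial factorisation and the codomain parts
`σ_f : E f ⟶ E (L f)` of the components `Σ_f = (1, σ_f)` of the comultiplication. -/
structure DomComonad extends FunFact C where
  /-- the comultiplication `σ` -/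
  sigma (f : Arrow C) : E.obj f ⟶ E.obj (toFunFact.L.obj f)
  sigma_naturality {f g : Arrow C} (φ : f ⟶ g) :
    E.map φ ≫ sigma g = sigma f ≫ E.map (toFunFact.L.map φ)
  lam_sigma (f : Arrow C) : lam f ≫ sigma f = lam (toFunFact.L.obj f)
  sigma_rho (f : Arrow C) : sigma f ≫ rho (toFunFact.L.obj f) = 𝟙 (E.obj f)
  sigma_counit (f : Arrow C) : sigma f ≫ E.map (toFunFact.counit f) = 𝟙 (E.obj f)
  coassoc (f : Arrow C) :
    sigma f ≫ sigma (toFunFact.L.obj f) =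
      sigma f ≫ E.map (Arrow.homMk (f := toFunFact.L.obj f)
        (g := toFunFact.L.obj (toFunFact.L.obj f)) (𝟙 f.left) (sigma f)
        ((Category.id_comp _).trans (lam_sigma f).symm))

variable (C) in
/-- A natural weak factorisation system: a comonad `(L, Φ, Σ)` over `dom` together with a monad
`(R, Λ, Π)` over `cod` on the same functorial factorisation, where `Π_f = (π_f, 1)`, such that
`Δ_f = (σ_f, π_f) : L R f ⟶ R L f` is a distributive law. -/
structure NWFS extends DomComonad C where
  /-- the multiplication `π` -/
  pi (f : Arrow C) : E.obj (toFunFact.R.obj f) ⟶ E.obj f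
  pi_naturality {f g : Arrow C} (φ : f ⟶ g) :
    E.map (toFunFact.R.map φ) ≫ pi g = pi f ≫ E.map φ
  pi_rho (f : Arrow C) : pi f ≫ rho f = rho (toFunFact.R.obj f)
  lam_pi (f : Arrow C) : lam (toFunFact.R.obj f) ≫ pi f = 𝟙 (E.obj f)
  unit_pi (f : Arrow C) : E.map (toFunFact.unit f) ≫ pi f = 𝟙 (E.obj f)
  assoc (f : Arrow C) :
    E.map (Arrow.homMk (f := toFunFact.R.obj (toFunFact.R.obj f)) (g := toFunFact.R.obj f)
        (pi f) (𝟙 f.right) ((pi_rho f).trans (Category.comp_id _).symm)) ≫ pi f =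
      pi (toFunFact.R.obj f) ≫ pi f
  distrib (f : Arrow C) :
    pi f ≫ sigma f =
      sigma (toFunFact.R.obj f) ≫
        E.map (Arrow.homMk (f := toFunFact.L.obj (toFunFact.R.obj f))
          (g := toFunFact.R.obj (toFunFact.L.obj f)) (sigma f) (pi f)
          ((sigma_rho f).trans (lam_pi f).symm)) ≫
        pi (toFunFact.L.obj f)

/-- A morphism of functorial factorisations. -/
@[ext]
structure FunFactHom (F G : FunFact C) where
  /-- the components `E f ⟶ E' f` -/
  app (f : Arrow C) : F.E.obj f ⟶ G.E.obj f
  naturality {f g : Arrow C} (φ : f ⟶ g) : F.E.map φ ≫ app g = app f ≫ G.E.map φ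
  lam_app (f : Arrow C) : F.lam f ≫ app f = G.lam f
  app_rho (f : Arrow C) : app f ≫ G.rho f = F.rho f

namespace FunFactHom

variable {F G : FunFact C} (a : FunFactHom F G)

/-- The induced map `(1, a_f) : L f ⟶ L' f`. -/
abbrev mapL (f : Arrow C) : F.L.obj f ⟶ G.L.obj f :=
  Arrow.homMk (f := F.L.obj f) (g := G.L.obj f) (𝟙 f.left) (a.app f)
    ((Category.id_comp _).trans (a.lam_app f).symm)

/-- The induced map `(a_f, 1) : R f ⟶ R' f`. -/
abbrev mapR (f : Arrow C) : F.R.obj f ⟶ G.R.obj f :=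
  Arrow.homMk (f := F.R.obj f) (g := G.R.obj f) (a.app f) (𝟙 f.right)
    ((a.app_rho f).trans (Category.comp_id _).symm)

end FunFactHom

/-- A morphism of functorial factorisations respects the comonad structures. -/
def IsComonadHom {F G : DomComonad C} (a : FunFactHom F.toFunFact G.toFunFact) : Prop :=
  ∀ f : Arrow C, a.app f ≫ G.sigma f =
    F.sigma f ≫ a.app (F.L.obj f) ≫ G.E.map (a.mapL f)

/-- A morphism of functorial factorisations respects the monad structures. -/
def IsMonadHom {M N : NWFS C} (a : FunFactHom M.toFunFact N.toFunFact) : Prop :=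
  ∀ f : Arrow C, M.pi f ≫ a.app f =
    a.app (M.R.obj f) ≫ N.E.map (a.mapR f) ≫ N.pi f

/-! ### `L`-maps and `R`-maps -/

/-- `L`-map structures on the map `f`, i.e. coalgebra structures on `f` for the comonad. -/
@[ext]
structure LStr (F : DomComonad C) (f : Arrow C) where
  /-- the structure map -/
  s : f.right ⟶ F.E.obj f
  hom_s : f.hom ≫ s = F.lam f
  s_rho : s ≫ F.rho f = 𝟙 f.right
  s_sigma : s ≫ F.sigma f =
    s ≫ F.E.map (Arrow.homMk (f := f) (g := F.L.obj f) (𝟙 f.left) s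
      ((Category.id_comp _).trans hom_s.symm))

/-- The square `φ` is a morphism of `L`-maps `(f, s) ⟶ (g, t)`. -/
def IsLHom {F : DomComonad C} {f g : Arrow C} (s : LStr F f) (t : LStr F g) (φ : f ⟶ g) : Prop :=
  φ.right ≫ t.s = s.s ≫ F.E.map φ

/-- `R`-map structures on the map `f`, i.e. algebra structures on `f` for the monad. -/
@[ext]
structure RStr (N : NWFS C) (f : Arrow C) where
  /-- the structure map -/
  p : N.E.obj f ⟶ f.left
  p_hom : p ≫ f.hom = N.rho f
  lam_p : N.lam f ≫ p = 𝟙 f.left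
  pi_p : N.pi f ≫ p =
    N.E.map (Arrow.homMk (f := N.R.obj f) (g := f) p (𝟙 f.right)
      (p_hom.trans (Category.comp_id _).symm)) ≫ p

/-- The square `φ` is a morphism of `R`-maps `(f, p) ⟶ (g, q)`. -/
def IsRHom {N : NWFS C} {f g : Arrow C} (p : RStr N f) (q : RStr N g) (φ : f ⟶ g) : Prop :=
  p.p ≫ φ.left = N.E.map φ ≫ q.p

/-- A morphism of comonads over `dom` turns `L`-maps into `L'`-maps. -/
def LStr.map {F G : DomComonad C} {a : FunFactHom F.toFunFact G.toFunFact} (ha : IsComonadHom a)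
    {f : Arrow C} (s : LStr F f) : LStr G f where
  s := s.s ≫ a.app f
  hom_s := by rw [← Category.assoc, s.hom_s, a.lam_app]
  s_rho := by rw [Category.assoc, a.app_rho, s.s_rho]
  s_sigma := by
    rw [Category.assoc, ha f, reassoc_of% s.s_sigma, ← Category.assoc (F.E.map _), a.naturality,
      Category.assoc, Category.assoc, ← G.E.map_comp]
    congr 3
    ext <;> simp

/-- The structure map of the composite `(h, u)`, where `h = g ∘ f`, of the `L`-maps
`(f, s) : X ⟶ Y` and `(g, t) : Y ⟶ Z`. -/
def compMap (N : NWFS C) {X Y Z : C} {f : X ⟶ Y} {g : Y ⟶ Z} {h : X ⟶ Z} (w : f ≫ g = h)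
    (s : LStr N.toDomComonad (Arrow.mk f)) (t : LStr N.toDomComonad (Arrow.mk g)) :
    Z ⟶ N.E.obj (Arrow.mk h) :=
  t.s ≫
    N.E.map (Arrow.homMk (f := Arrow.mk g) (g := Arrow.mk (N.rho (Arrow.mk f) ≫ g)) s.s (𝟙 Z)
      (by simpa using congrArg (fun k => k ≫ g) s.s_rho)) ≫
    N.E.map (Arrow.homMk (f := Arrow.mk (N.rho (Arrow.mk f) ≫ g)) (g := N.R.obj (Arrow.mk h))
      (N.E.map (Arrow.homMk (f := Arrow.mk f) (g := Arrow.mk h) (𝟙 X) g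
        ((Category.id_comp _).trans w.symm))) (𝟙 Z)
      ((N.rho_naturality _).trans (Category.comp_id _).symm)) ≫
    N.pi (Arrow.mk h)

/-- `(h, u)` is the composite of the `L`-maps `(f, s)` and `(g, t)`. -/
def IsComp (N : NWFS C) {X Y Z : C} {f : X ⟶ Y} {g : Y ⟶ Z} {h : X ⟶ Z}
    (s : LStr N.toDomComonad (Arrow.mk f)) (t : LStr N.toDomComonad (Arrow.mk g))
    (u : LStr N.toDomComonad (Arrow.mk h)) : Prop :=
  ∃ w : f ≫ g = h, u.s = compMap N w s t

/-! ### The one-step comonad of a family of maps -/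

section OneStep

variable {ι : Type w} (J : ι → Arrow C)

/-- The set `S_g` of lifting problems against `g` of members of `J`. -/
abbrev Squares (g : Arrow C) : Type w := Σ i : ι, (J i ⟶ g)

variable [HasColimits C]

/-- `E¹ g`: the pushout of `∑ A_x ⟶ ∑ B_x` along `∑ A_x ⟶ C`, where `x` runs over `S_g`. -/
noncomputable def stepObj (g : Arrow C) : C :=
  pushout (Sigma.desc fun x : Squares J g => x.2.left)
    (Limits.Sigma.map fun x : Squares J g => (J x.1).hom)

/-- `λ¹_g` -/
noncomputable def stepLam (g : Arrow C) : g.left ⟶ stepObj J g :=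
  pushout.inl _ _

variable {J} in
/-- The cell of `E¹ g` attached by the lifting problem `x`. -/
noncomputable def stepCell {g : Arrow C} {i : ι} (x : J i ⟶ g) : (J i).right ⟶ stepObj J g :=
  Sigma.ι (fun x : Squares J g => (J x.1).right) ⟨i, x⟩ ≫ pushout.inr _ _

lemma hom_stepCell {g : Arrow C} {i : ι} (x : J i ⟶ g) :
    (J i).hom ≫ stepCell x = x.left ≫ stepLam J g := by
  have h := congrArg (fun k => Sigma.ι (fun x : Squares J g => (J x.1).left) ⟨i, x⟩ ≫ k)
    (pushout.condition (f := Sigma.desc fun x : Squares J g => x.2.left)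
      (g := Limits.Sigma.map fun x : Squares J g => (J x.1).hom))
  simp only [← Category.assoc, Sigma.ι_desc, Limits.Sigma.ι_map] at h
  exact (Category.assoc _ _ _).symm.trans h.symm

/-- The universal property of `E¹ g`. -/
noncomputable def stepDesc {g : Arrow C} {Z : C} (a : g.left ⟶ Z)
    (b : ∀ (i : ι) (_ : J i ⟶ g), (J i).right ⟶ Z)
    (h : ∀ (i : ι) (x : J i ⟶ g), (J i).hom ≫ b i x = x.left ≫ a) : stepObj J g ⟶ Z :=
  pushout.desc a (Sigma.desc fun x : Squares J g => b x.1 x.2) (by ext x; simp [h])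

@[simp]
lemma stepLam_desc {g : Arrow C} {Z : C} (a : g.left ⟶ Z)
    (b : ∀ (i : ι) (_ : J i ⟶ g), (J i).right ⟶ Z)
    (h : ∀ (i : ι) (x : J i ⟶ g), (J i).hom ≫ b i x = x.left ≫ a) :
    stepLam J g ≫ stepDesc J a b h = a :=
  pushout.inl_desc _ _ _

@[simp]
lemma stepCell_desc {g : Arrow C} {Z : C} (a : g.left ⟶ Z)
    (b : ∀ (i : ι) (_ : J i ⟶ g), (J i).right ⟶ Z)
    (h : ∀ (i : ι) (x : J i ⟶ g), (J i).hom ≫ b i x = x.left ≫ a) {i : ι} (x : J i ⟶ g) :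
    stepCell x ≫ stepDesc J a b h = b i x := by
  refine (Category.assoc _ _ _).trans ((congrArg _ (pushout.inr_desc _ _ _)).trans ?_)
  exact Sigma.ι_desc _ _

@[simp]
lemma stepLam_desc_assoc {g : Arrow C} {Z W : C} (a : g.left ⟶ Z)
    (b : ∀ (i : ι) (_ : J i ⟶ g), (J i).right ⟶ Z)
    (h : ∀ (i : ι) (x : J i ⟶ g), (J i).hom ≫ b i x = x.left ≫ a) (k : Z ⟶ W) :
    stepLam J g ≫ stepDesc J a b h ≫ k = a ≫ k := by
  rw [← Category.assoc, stepLam_desc]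

@[simp]
lemma stepCell_desc_assoc {g : Arrow C} {Z W : C} (a : g.left ⟶ Z)
    (b : ∀ (i : ι) (_ : J i ⟶ g), (J i).right ⟶ Z)
    (h : ∀ (i : ι) (x : J i ⟶ g), (J i).hom ≫ b i x = x.left ≫ a) {i : ι} (x : J i ⟶ g)
    (k : Z ⟶ W) :
    stepCell x ≫ stepDesc J a b h ≫ k = b i x ≫ k := by
  rw [← Category.assoc, stepCell_desc]

lemma step_hom_ext {g : Arrow C} {Z : C} {a b : stepObj J g ⟶ Z}
    (h : stepLam J g ≫ a = stepLam J g ≫ b)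
    (h' : ∀ (i : ι) (x : J i ⟶ g), stepCell x ≫ a = stepCell x ≫ b) : a = b := by
  apply pushout.hom_ext
  · exact h
  · refine Sigma.hom_ext _ _ (fun x => ?_)
    exact ((Category.assoc _ _ _).symm.trans (h' x.1 x.2)).trans (Category.assoc _ _ _)

/-- The action of `E¹` on a square `φ : g ⟶ g'`. -/
noncomputable def stepMap {g g' : Arrow C} (φ : g ⟶ g') : stepObj J g ⟶ stepObj J g' :=
  stepDesc J (φ.left ≫ stepLam J g') (fun _ x => stepCell (x ≫ φ))
    (fun _ x => by simpa using hom_stepCell J (x ≫ φ))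

lemma stepLam_map {g g' : Arrow C} (φ : g ⟶ g') :
    stepLam J g ≫ stepMap J φ = φ.left ≫ stepLam J g' :=
  stepLam_desc ..

lemma stepCell_map {g g' : Arrow C} (φ : g ⟶ g') {i : ι} (x : J i ⟶ g) :
    stepCell x ≫ stepMap J φ = stepCell (x ≫ φ) :=
  stepCell_desc ..

/-- `ρ¹_g` -/
noncomputable def stepRho (g : Arrow C) : stepObj J g ⟶ g.right :=
  stepDesc J g.hom (fun _ x => x.right) (fun _ x => (Arrow.w x).symm)

lemma stepCell_rho {g : Arrow C} {i : ι} (x : J i ⟶ g) :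
    stepCell x ≫ stepRho J g = x.right :=
  stepCell_desc ..

/-- The functorial factorisation `(E¹, λ¹, ρ¹)`. -/
noncomputable abbrev stepFact : FunFact C where
  E :=
    { obj := stepObj J
      map := stepMap J
      map_id := fun g => step_hom_ext J (by simp [stepMap]) (fun _ x => by simp [stepMap])
      map_comp := fun φ ψ => step_hom_ext J (by simp [stepMap]) (fun _ x => by simp [stepMap]) }
  lam := stepLam J
  rho := stepRho J
  lam_naturality φ := by simp [stepMap]
  rho_naturality φ := step_hom_ext J (by simp [stepMap, stepRho])
    (fun _ x => by simp [stepMap, stepRho])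
  fac g := by simp [stepRho]

/-- The cell attached by `x : f ⟶ g`, seen as a square `f ⟶ λ¹_g`. -/
noncomputable def stepSquare {g : Arrow C} {i : ι} (x : J i ⟶ g) :
    J i ⟶ Arrow.mk (stepLam J g) :=
  Arrow.homMk (f := J i) (g := Arrow.mk (stepLam J g)) x.left (stepCell x)
    (hom_stepCell J x).symm

/-- `σ¹_g`, sending the cell attached by `x` to the cell attached by `f_x ⟶ λ¹_g`. -/
noncomputable def stepSigma (g : Arrow C) : stepObj J g ⟶ stepObj J (Arrow.mk (stepLam J g)) :=
  stepDesc J (stepLam J (Arrow.mk (stepLam J g))) (fun _ x => stepCell (stepSquare J x))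
    (fun _ x => hom_stepCell J (stepSquare J x))

lemma stepLam_sigma (g : Arrow C) :
    stepLam J g ≫ stepSigma J g = stepLam J (Arrow.mk (stepLam J g)) :=
  stepLam_desc ..

lemma stepCell_sigma {g : Arrow C} {i : ι} (x : J i ⟶ g) :
    stepCell x ≫ stepSigma J g = stepCell (stepSquare J x) :=
  stepCell_desc ..

/-- The one-step comonad generated by `J`. -/
noncomputable abbrev oneStep : DomComonad C where
  toFunFact := stepFact J
  sigma := stepSigma J
  sigma_naturality {g g'} φ := by
    change stepMap J φ ≫ stepSigma J g' = stepSigma J g ≫ stepMap J ((stepFact J).L.map φ)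
    refine step_hom_ext J ?_ (fun i x => ?_)
    · rw [reassoc_of% stepLam_map, stepLam_sigma, reassoc_of% stepLam_sigma, stepLam_map]
      rfl
    · rw [reassoc_of% stepCell_map, stepCell_sigma, reassoc_of% stepCell_sigma, stepCell_map]
      refine congrArg stepCell (Arrow.hom_ext _ _ rfl ?_)
      exact (stepCell_map J φ x).symm
  lam_sigma g := stepLam_sigma J g
  sigma_rho g := by
    change stepSigma J g ≫ stepRho J (Arrow.mk (stepLam J g)) = 𝟙 (stepObj J g)
    refine step_hom_ext J ?_ (fun i x => ?_)
    · rw [reassoc_of% stepLam_sigma, Category.comp_id]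
      exact stepLam_desc ..
    · rw [reassoc_of% stepCell_sigma, Category.comp_id]
      exact stepCell_desc ..
  sigma_counit g := by
    change stepSigma J g ≫ stepMap J ((stepFact J).counit g) = 𝟙 (stepObj J g)
    refine step_hom_ext J ?_ (fun i x => ?_)
    · rw [reassoc_of% stepLam_sigma, stepLam_map, Category.comp_id]
      exact Category.id_comp _
    · rw [reassoc_of% stepCell_sigma, stepCell_map, Category.comp_id]
      exact congrArg stepCell (Arrow.hom_ext _ _ (Category.comp_id _) (stepCell_rho J x))
  coassoc g := by
    change stepSigma J g ≫ stepSigma J (Arrow.mk (stepLam J g)) = stepSigma J g ≫ stepMap J _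
    refine step_hom_ext J ?_ (fun i x => ?_)
    · rw [reassoc_of% stepLam_sigma, stepLam_sigma, reassoc_of% stepLam_sigma, stepLam_map]
      exact (Category.id_comp _).symm
    · rw [reassoc_of% stepCell_sigma, stepCell_sigma, reassoc_of% stepCell_sigma, stepCell_map]
      exact congrArg stepCell (Arrow.hom_ext _ _ (Category.comp_id _).symm
        (stepCell_sigma J x).symm)

/-- The canonical structure of a map for the one-step comonad on a member of `J`. -/
noncomputable def stepStr (i : ι) : LStr (oneStep J) (J i) where
  s := stepCell (𝟙 (J i))
  hom_s := (hom_stepCell J (𝟙 (J i))).trans (Category.id_comp _)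
  s_rho := stepCell_rho J (𝟙 (J i))
  s_sigma := by
    change stepCell (𝟙 (J i)) ≫ stepSigma J (J i) = stepCell (𝟙 (J i)) ≫ stepMap J _
    rw [stepCell_sigma, stepCell_map, Category.id_comp]
    rfl

/-- `N` is generated by `J`, with `α` the induced `L`-map structures on the members of `J`:
there is a comonad morphism `χ` from the one-step comonad to the comonad of `N` that exhibits `N`
as the free monoid on the (uniquely) pointed object given by the one-step comonad, where monoids in
comonads over `dom` are natural weak factorisation systems; and `α` is the image under `χ` of the
canonical structures. -/
def NWFS.IsGeneratedBy (N : NWFS C) (α : ∀ i, LStr N.toDomComonad (J i)) : Prop :=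
  ∃ (χ : FunFactHom (oneStep J).toFunFact N.toFunFact)
    (hχ : IsComonadHom (F := oneStep J) (G := N.toDomComonad) χ),
    (∀ (M : NWFS C) (ψ : FunFactHom (oneStep J).toFunFact M.toFunFact),
      IsComonadHom (F := oneStep J) (G := M.toDomComonad) ψ →
      ∃! φ : FunFactHom N.toFunFact M.toFunFact,
        IsComonadHom (F := N.toDomComonad) (G := M.toDomComonad) φ ∧ IsMonadHom φ ∧
          ∀ f, χ.app f ≫ φ.app f = ψ.app f) ∧
    ∀ i, α i = LStr.map (G := N.toDomComonad) hχ (stepStr J i)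

end OneStep

/-! ### Cofibrant generation -/

section CofGen

variable {ι : Type w} (J : ι → Arrow C)

/-- Right lifting data for `g` with respect to `J`. -/
@[ext]
structure LiftingData (g : Arrow C) where
  /-- the chosen fillers -/
  fill (i : ι) (x : J i ⟶ g) : (J i).right ⟶ g.left
  hom_fill (i : ι) (x : J i ⟶ g) : (J i).hom ≫ fill i x = x.left
  fill_hom (i : ι) (x : J i ⟶ g) : fill i x ≫ g.hom = x.right

variable {J} in
/-- The square `φ` commutes with the right lifting data `δ` and `δ'`. -/
def IsLiftingHom {g g' : Arrow C} (δ : LiftingData J g) (δ' : LiftingData J g') (φ : g ⟶ g') :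
    Prop :=
  ∀ (i : ι) (x : J i ⟶ g), δ.fill i x ≫ φ.left = δ'.fill i (x ≫ φ)

variable {J} in
/-- The right lifting data on an `R`-map determined by `L`-map structures on the members of `J`. -/
def RStr.lifting {N : NWFS C} (α : ∀ i, LStr N.toDomComonad (J i)) {g : Arrow C} (p : RStr N g) :
    LiftingData J g where
  fill i x := (α i).s ≫ N.E.map x ≫ p.p
  hom_fill i x := by
    rw [reassoc_of% (α i).hom_s, ← Category.assoc, ← N.lam_naturality, Category.assoc, p.lam_p,
      Category.comp_id]
  fill_hom i x := by
    rw [Category.assoc, Category.assoc, p.p_hom, N.rho_naturality, reassoc_of% (α i).s_rho]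

/-- `N` is cofibrantly generated by `(J, α)`: the functor over `Ar C` from `R`-maps to maps with
right lifting data is an isomorphism of categories, i.e. bijective on objects and on morphisms. -/
def NWFS.IsCofibrantlyGeneratedBy (N : NWFS C) (α : ∀ i, LStr N.toDomComonad (J i)) : Prop :=
  (∀ g : Arrow C, Function.Bijective fun p : RStr N g => p.lifting α) ∧
  ∀ (g g' : Arrow C) (p : RStr N g) (q : RStr N g') (φ : g ⟶ g'),
    IsRHom p q φ ↔ IsLiftingHom (p.lifting α) (q.lifting α) φ

end CofGen

/-! ### Pushouts of coproducts, transfinite composites and retract equalisers of `L`-maps -/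

section Operations

variable {ι : Type w} {J : ι → Arrow C} {N : NWFS C}

/-- A map `f` obtained by attaching cells is, with the `L`-map structure `s`, the pushout in
`L`-maps of the coproduct in `L`-maps of the corresponding members of `J`. -/
def IsAttachStr (α : ∀ i, LStr N.toDomComonad (J i)) {X Y : C} {f : X ⟶ Y}
    (c : HomotopicalAlgebra.AttachCells.{w} (fun i => (J i).hom) f)
    (s : LStr N.toDomComonad (Arrow.mk f)) : Prop :=
  ∃ m : LStr N.toDomComonad (Arrow.mk c.m),
    (∀ k : c.ι, IsLHom (α (c.π k)) m
      (Arrow.homMk (f := J (c.π k)) (g := Arrow.mk c.m) (c.cofan₁.inj k) (c.cofan₂.inj k)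
        (c.hm k))) ∧
    IsLHom m s (Arrow.homMk (f := Arrow.mk c.m) (g := Arrow.mk f) c.g₁ c.g₂ c.isPushout.w)

/-- `f`, a transfinite composite of pushouts of coproducts of members of `J`, is with the `L`-map
structure `s` the corresponding transfinite composite in the category of objects of `C` and
`L`-maps between them. That is, the chain and its colimit cocone are lifted to that category, the
successor steps being pushouts of coproducts of the `(J i, α i)`. -/
def IsCellStr (α : ∀ i, LStr N.toDomComonad (J i)) {K : Type w} [LinearOrder K] [OrderBot K]
    [SuccOrder K] [WellFoundedLT K] {X Y : C} {f : X ⟶ Y}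
    (c : HomotopicalAlgebra.RelativeCellComplex.{w} (fun (_ : K) i => (J i).hom) f)
    (s : LStr N.toDomComonad (Arrow.mk f)) : Prop :=
  ∃ (str : ∀ {a b : K} (h : a ≤ b), LStr N.toDomComonad (Arrow.mk (c.F.map (homOfLE h))))
    (tot : ∀ a : K, LStr N.toDomComonad (Arrow.mk (Y := Y) (c.incl.app a))),
    (∀ {a b d : K} (h : a ≤ b) (h' : b ≤ d), IsComp N (str h) (str h') (str (h.trans h'))) ∧
    (∀ {a b : K} (h : a ≤ b), IsComp N (str h) (tot b) (tot a)) ∧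
    (∀ (a : K) (ha : ¬ IsMax a), IsAttachStr α (c.attachCells a ha) (str (Order.le_succ a))) ∧
    IsLHom (tot ⊥) s (Arrow.homMk (f := Arrow.mk (Y := Y) (c.incl.app ⊥)) (g := Arrow.mk f)
      c.isoBot.hom (𝟙 Y)
      (((congrArg (fun k => c.isoBot.hom ≫ k) c.fac.symm).trans
        (Iso.hom_inv_id_assoc _ _)).trans (Category.comp_id _).symm))

/-- A contractible equaliser `f ⟶ g ⇉ h` in `Ar C` together with a lifting of the parallel pair to
`L`-maps `(g, s) ⇉ (h, t)`. -/
structure ContractiblePair (F : DomComonad C) (f : Arrow C) {g : Arrow C} (s : LStr F g) where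
  /-- the third map -/
  h : Arrow C
  /-- its `L`-map structure -/
  t : LStr F h
  /-- the inclusion of `f` into `g` -/
  i : f ⟶ g
  /-- the retraction of `i` -/
  p : g ⟶ f
  /-- the first map of the parallel pair -/
  j : g ⟶ h
  /-- the second map of the parallel pair -/
  k : g ⟶ h
  /-- the retraction of `j` -/
  q : h ⟶ g
  i_p : i ≫ p = 𝟙 f
  j_q : j ≫ q = 𝟙 g
  i_j : i ≫ j = i ≫ k
  k_q : k ≫ q = p ≫ i
  hom_j : IsLHom s t j
  hom_k : IsLHom s t k

end Operations

/-! ### Smallness -/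

/-- A well-ordered set is `α`-filtered if it has limit order type and each of its subsets of
cardinality at most `α` is bounded. -/
def IsFilteredOrd (α : Cardinal.{w}) (K : Type w) [LinearOrder K] : Prop :=
  NoMaxOrder K ∧ ∀ S : Set K, Cardinal.mk S ≤ α → BddAbove S

/-- `T` preserves colimits of chains, with all connecting maps in `M`, indexed by `α`-filtered
ordinals. -/
def IsSmallRel (M : MorphismProperty C) {D : Type*} [Category* D] (α : Cardinal.{w})
    (T : C ⥤ D) : Prop :=
  ∀ (K : Type w) [LinearOrder K] [WellFoundedLT K], IsFilteredOrd α K →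
    ∀ F : K ⥤ C, (∀ {a b : K} (h : a ⟶ b), M (F.map h)) → PreservesColimit F T

/-- `T` preserves colimits of chains indexed by `α`-filtered ordinals. -/
def IsSmall {D : Type*} [Category* D] (α : Cardinal.{w}) (T : C ⥤ D) : Prop :=
  ∀ (K : Type w) [LinearOrder K] [WellFoundedLT K], IsFilteredOrd α K →
    PreservesColimitsOfShape K T

/-- An orthogonal factorisation system. -/
structure IsOrthogonalFactorizationSystem (E M : MorphismProperty C) : Prop where
  left_retracts : E.IsStableUnderRetracts
  right_retracts : M.IsStableUnderRetracts
  unique_lift {A B X Y : C} (e : A ⟶ B) (m : X ⟶ Y) (f : A ⟶ X) (g : B ⟶ Y) :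
    E e → M m → f ≫ m = e ≫ g → ∃! j : B ⟶ X, e ≫ j = f ∧ j ≫ m = g
  hasFactorization : E.HasFactorization M

/-- Each object is the domain of only a (small) set of `E`-maps up to isomorphism. -/
def IsCowellpowered (E : MorphismProperty C) : Prop :=
  ∀ X : C, ∃ (I : Type w) (e : I → Under X), ∀ Y : Under X, E Y.hom → ∃ i, Nonempty (Y ≅ e i)

/-- The domains `A_j` of the members of `J` are small: either each `C(A_j, -)` is `α_j`-small for
some cardinal `α_j`, or there is a cowellpowered orthogonal factorisation system `(E, M)` on `C`
such that each `C(A_j, -)` is `α_j`-small relative to `M` for some cardinal `α_j`. -/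
def HasSmallDomains {ι : Type w} (J : ι → Arrow C) : Prop :=
  (∀ i, ∃ α : Cardinal.{w}, IsSmall α (coyoneda.obj (Opposite.op (J i).left))) ∨
  ∃ E M : MorphismProperty C, IsOrthogonalFactorizationSystem E M ∧ IsCowellpowered E ∧
    ∀ i, ∃ α : Cardinal.{w}, IsSmallRel M α (coyoneda.obj (Opposite.op (J i).left))

end NatWFS

namespace NatWFS

variable {C : Type u} [Category.{w} C]


/-! ### The algebra of `L`-maps -/

namespace FunFact

variable (F : FunFact C)

/-! Part (1). An `L`-map structure on a map is determined by its restriction along any family of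
`L`-maps into it that is jointly epic on codomains relative to the domain, and all axioms except
`hom_s` can be checked after that restriction. Hence coproducts, pushouts and colimits of chains of
`L`-maps are formed on underlying maps and carry exactly one structure making the legs morphisms.
Composites of `L`-maps are `L`-maps by the distributive law, and associative by associativity of
`π`. For a fixed lower stage `x` of a cell complex, transfinite recursion on the upper stage `y`
then gives one structure on the map from `x` to `y`: composition with the attached cells at
successors, colimits at limits. Functoriality in `x` is a consequence of uniqueness. For a retract
equaliser, the splittings and naturality of the two `L`-morphisms show that `s` restricted along `i`
factors through `E f`, which gives the structure on `f`.

Part (2). The small object argument factors `f` as a cell complex `i` followed by a map `h` with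
right lifting data, so by the retract argument it is enough to find `t` with `t ∘ f = i` and `h ∘ t
= 1`. If `N` is cofibrantly generated, lifting data on `h` come from an algebra structure, and an
`L`-map lifts against an algebra. If `N` is only known by its universal property, a second n.w.f.s.
is built to map into: its middle objects carry the free right lifting data. These are obtained by a
transfinite chain in which every attached cell is marked, and a marked cell is identified at the
next stage with the new cell on the same boundary, so that fillers become unique among marked cells.
The one-step comonad maps to this n.w.f.s.; hence so does `N`, the structure on `f` is transported
along this map, and freeness applied to the lifting data on `h` finishes the construction of `t`.

Both chains run over all ordinals and are stopped at a stage where they converge on the domains of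
`J`. In the case relative to `(𝓔, 𝓜)`, the `𝓔`-images of each stage in later stages stabilise by
cowellpoweredness, and the stable images form a chain of `𝓜`-maps interleaved with the given one. -/

lemma map_map_eq {f g h : Arrow C} (φ : f ⟶ g) (ψ : g ⟶ h) (χ : f ⟶ h)
    (hl : φ.left ≫ ψ.left = χ.left) (hr : φ.right ≫ ψ.right = χ.right) :
    F.E.map φ ≫ F.E.map ψ = F.E.map χ := by
  rw [← F.E.map_comp]
  exact congrArg F.E.map (Arrow.hom_ext _ _ hl hr)

lemma map_map_eq_map_map {f g g' h : Arrow C} (φ : f ⟶ g) (ψ : g ⟶ h) (φ' : f ⟶ g') (ψ' : g' ⟶ h)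
    (hl : φ.left ≫ ψ.left = φ'.left ≫ ψ'.left) (hr : φ.right ≫ ψ.right = φ'.right ≫ ψ'.right) :
    F.E.map φ ≫ F.E.map ψ = F.E.map φ' ≫ F.E.map ψ' := by
  rw [← F.E.map_comp, ← F.E.map_comp]
  exact congrArg F.E.map (Arrow.hom_ext _ _ hl hr)

end FunFact

section LMaps

variable {F : DomComonad C}

/-- The square `f ⟶ L f` with components `1` and `s`. -/
abbrev LStr.sq {f : Arrow C} (s : LStr F f) : f ⟶ F.L.obj f :=
  Arrow.homMk (f := f) (g := F.L.obj f) (𝟙 f.left) s.s ((Category.id_comp _).trans s.hom_s.symm)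

lemma IsLHom.comp {f g h : Arrow C} {s : LStr F f} {t : LStr F g} {r : LStr F h} {φ : f ⟶ g}
    {ψ : g ⟶ h} (hφ : IsLHom s t φ) (hψ : IsLHom t r ψ) : IsLHom s r (φ ≫ ψ) := by
  unfold IsLHom at *
  rw [Arrow.comp_right, Category.assoc, hψ, reassoc_of% hφ, F.E.map_comp]

lemma IsLHom.id {f : Arrow C} (s : LStr F f) : IsLHom s s (𝟙 f) := by
  simp [IsLHom]

/-- A family of squares into `g` is jointly epic on codomains, relative to the domain of `g`. -/
def JointlyEpi {K : Type*} {f : K → Arrow C} {g : Arrow C} (φ : ∀ k, f k ⟶ g) : Prop :=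
  ∀ (Z : C) (a b : g.right ⟶ Z), g.hom ≫ a = g.hom ≫ b →
    (∀ k, (φ k).right ≫ a = (φ k).right ≫ b) → a = b

/-- A structure map on `g` compatible with those of a jointly epic family of `L`-maps over `g` is
an `L`-map structure. -/
def LStr.ofJointlyEpi {K : Type*} {f : K → Arrow C} {g : Arrow C} {φ : ∀ k, f k ⟶ g}
    (hφ : JointlyEpi φ) (t : ∀ k, LStr F (f k)) (s : g.right ⟶ F.E.obj g)
    (hom_s : g.hom ≫ s = F.lam g) (hs : ∀ k, (φ k).right ≫ s = (t k).s ≫ F.E.map (φ k)) :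
    LStr F g where
  s := s
  hom_s := hom_s
  s_rho := by
    refine hφ _ _ _ ?_ (fun k => ?_)
    · rw [reassoc_of% hom_s, F.fac, Category.comp_id]
    · rw [reassoc_of% hs k, F.rho_naturality, reassoc_of% (t k).s_rho, Category.comp_id]
  s_sigma := by
    refine hφ _ _ _ ?_ (fun k => ?_)
    · rw [reassoc_of% hom_s, reassoc_of% hom_s, F.lam_sigma, ← F.lam_naturality]
      exact (Category.id_comp _).symm
    · rw [reassoc_of% hs k, reassoc_of% hs k, F.sigma_naturality, reassoc_of% (t k).s_sigma,
        F.map_map_eq_map_map]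
      · simp
      · simp [hs k]

lemma LStr.ext_of_jointlyEpi {K : Type*} {f : K → Arrow C} {g : Arrow C} {φ : ∀ k, f k ⟶ g}
    (hφ : JointlyEpi φ) {t : ∀ k, LStr F (f k)} {s s' : LStr F g}
    (hs : ∀ k, IsLHom (t k) s (φ k)) (hs' : ∀ k, IsLHom (t k) s' (φ k)) : s = s' :=
  LStr.ext (hφ _ _ _ (s.hom_s.trans s'.hom_s.symm) (fun k => (hs k).trans (hs' k).symm))

lemma LStr.eq_of_isIso {f : Arrow C} [IsIso f.hom] (s t : LStr F f) : s = t :=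
  LStr.ext ((cancel_epi f.hom).1 (s.hom_s.trans t.hom_s.symm))

/-- The unique `L`-map structure on an isomorphism. -/
noncomputable def LStr.ofIsIso (F : DomComonad C) (f : Arrow C) [IsIso f.hom] : LStr F f :=
  LStr.ofJointlyEpi (K := PEmpty.{1}) (f := fun _ => f) (φ := fun k => k.elim)
    (fun _ _ _ h _ => (cancel_epi f.hom).1 h) (fun k => k.elim) (inv f.hom ≫ F.lam f)
    (IsIso.hom_inv_id_assoc _ _) (fun k => k.elim)

lemma existsUnique_isLHom_of_isIso {f g : Arrow C} (φ : f ⟶ g) [IsIso φ] (s : LStr F f) :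
    ∃! t : LStr F g, IsLHom s t φ := by
  have hφ : JointlyEpi (K := Unit) (fun _ => φ) := fun _ _ _ _ h => (cancel_epi φ.right).1 (h ())
  refine ⟨LStr.ofJointlyEpi hφ (fun _ => s) (inv φ.right ≫ s.s ≫ F.E.map φ) ?_
    (fun _ => IsIso.hom_inv_id_assoc _ _), IsIso.hom_inv_id_assoc _ _,
    fun t ht => LStr.ext_of_jointlyEpi hφ (t := fun _ => s) (fun _ => ht)
      (fun _ => IsIso.hom_inv_id_assoc _ _)⟩
  rw [← cancel_epi φ.left, Arrow.w_assoc, IsIso.hom_inv_id_assoc, reassoc_of% s.hom_s,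
    F.lam_naturality]

/-- The `L`-map structure induced on the equaliser of a contractible pair. -/
lemma exists_isLHom_of_contractiblePair {f g : Arrow C} {s : LStr F g}
    (D : ContractiblePair F f s) :
    ∃ r : LStr F f, r.s = D.i.right ≫ s.s ≫ F.E.map D.p ∧ IsLHom r s D.i := by
  have hmono : F.E.map D.i ≫ F.E.map D.p = 𝟙 _ := by rw [← F.E.map_comp, D.i_p, F.E.map_id]
  -- Writing `pi` as `qk`, the two morphism conditions turn `E(qk)·s·i` into `E(q)·t·k·i =
  -- E(q)·t·j·i = E(qj)·s·i`, which is `s·i` since `qj = 1`.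
  have key : (D.i.right ≫ s.s ≫ F.E.map D.p) ≫ F.E.map D.i = D.i.right ≫ s.s := by
    have hk : s.s ≫ F.E.map D.k = D.k.right ≫ D.t.s := D.hom_k.symm
    have hj : s.s ≫ F.E.map D.j = D.j.right ≫ D.t.s := D.hom_j.symm
    have hij : D.i.right ≫ D.j.right = D.i.right ≫ D.k.right := by
      rw [← Arrow.comp_right, D.i_j, Arrow.comp_right]
    rw [Category.assoc, Category.assoc, ← F.E.map_comp, ← D.k_q, F.E.map_comp, reassoc_of% hk,
      ← reassoc_of% hij, ← reassoc_of% hj, ← F.E.map_comp, D.j_q, F.E.map_id, Category.comp_id]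
  have hom_r : f.hom ≫ D.i.right ≫ s.s ≫ F.E.map D.p = F.lam f := by
    rw [← Arrow.w_assoc, reassoc_of% s.hom_s, ← Category.assoc, F.lam_naturality, Category.assoc,
      hmono, Category.comp_id]
  have hright : D.i.right ≫ D.p.right = 𝟙 _ := by rw [← Arrow.comp_right, D.i_p]; rfl
  refine ⟨⟨D.i.right ≫ s.s ≫ F.E.map D.p, hom_r, ?_, ?_⟩, rfl, key.symm⟩
  · rw [Category.assoc, Category.assoc, F.rho_naturality, reassoc_of% s.s_rho, hright]
  · rw [Category.assoc, Category.assoc, F.sigma_naturality, reassoc_of% s.s_sigma,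
      ← reassoc_of% key, ← F.E.map_comp, ← F.E.map_comp, ← F.E.map_comp, Category.assoc,
      Category.assoc, ← F.E.map_comp]
    have hl : D.i.left ≫ D.p.left = 𝟙 _ := by rw [← Arrow.comp_left, D.i_p]; rfl
    congr 4
    ext
    · simp [hl]
    · simp

end LMaps

/-! ### Composition of `L`-maps -/

section Composition

variable {N : NWFS C}

/-- The square `g ⟶ R h`, for `h = g ∘ f`, determined by an `L`-map structure on `f`. -/
abbrev compSq (N : NWFS C) {X Y Z : C} {f : X ⟶ Y} {g : Y ⟶ Z} {h : X ⟶ Z} (w : f ≫ g = h)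
    (s : LStr N.toDomComonad (Arrow.mk f)) : Arrow.mk g ⟶ N.R.obj (Arrow.mk h) :=
  Arrow.homMk (f := Arrow.mk g) (g := N.R.obj (Arrow.mk h))
    (s.s ≫ N.E.map (Arrow.homMk (f := Arrow.mk f) (g := Arrow.mk h) (𝟙 X) g
      ((Category.id_comp _).trans w.symm))) (𝟙 Z) (by
        have h1 := s.s_rho
        dsimp at h1 ⊢
        rw [Category.assoc, N.rho_naturality, reassoc_of% h1, Category.comp_id]
        rfl)

lemma compMap_eq {X Y Z : C} {f : X ⟶ Y} {g : Y ⟶ Z} {h : X ⟶ Z} (w : f ≫ g = h)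
    (s : LStr N.toDomComonad (Arrow.mk f)) (t : LStr N.toDomComonad (Arrow.mk g)) :
    compMap N w s t = t.s ≫ N.E.map (compSq N w s) ≫ N.pi (Arrow.mk h) := by
  unfold compMap
  congr 1
  rw [← Category.assoc]
  congr 1
  exact N.map_map_eq _ _ _ rfl (Category.comp_id _)

/-- The square `f ⟶ g ∘ f` with components `1` and `g`. -/
abbrev rightSq {X Y Z : C} {f : X ⟶ Y} {g : Y ⟶ Z} {h : X ⟶ Z} (w : f ≫ g = h) :
    Arrow.mk f ⟶ Arrow.mk h :=
  Arrow.homMk (f := Arrow.mk f) (g := Arrow.mk h) (𝟙 X) g ((Category.id_comp _).trans w.symm)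

/-- This is what makes the first factor map to the composite by a morphism of `L`-maps. It rests on
the unit law `λ_{ρ} ≫ π = 1`. -/
lemma comp_compMap {X Y Z : C} {f : X ⟶ Y} {g : Y ⟶ Z} {h : X ⟶ Z} (w : f ≫ g = h)
    (s : LStr N.toDomComonad (Arrow.mk f)) (t : LStr N.toDomComonad (Arrow.mk g)) :
    g ≫ compMap N w s t = s.s ≫ N.E.map (rightSq w) := by
  have h1 : g ≫ t.s = N.lam (Arrow.mk g) := t.hom_s
  rw [compMap_eq, reassoc_of% h1, ← Category.assoc, ← N.lam_naturality, Category.assoc, N.lam_pi]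
  exact Category.comp_id _

/-- The composite of two `L`-maps. -/
def compStr {X Y Z : C} {f : X ⟶ Y} {g : Y ⟶ Z} {h : X ⟶ Z} (w : f ≫ g = h)
    (s : LStr N.toDomComonad (Arrow.mk f)) (t : LStr N.toDomComonad (Arrow.mk g)) :
    LStr N.toDomComonad (Arrow.mk h) where
  s := compMap N w s t
  hom_s := by
    have h1 : f ≫ s.s = N.lam (Arrow.mk f) := s.hom_s
    have h2 : h ≫ compMap N w s t = f ≫ g ≫ compMap N w s t := by
      rw [← Category.assoc]
      exact congrArg (fun k => k ≫ compMap N w s t) w.symm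
    refine h2.trans ?_
    rw [comp_compMap w s t, reassoc_of% h1, ← N.lam_naturality]
    exact Category.id_comp _
  s_rho := by
    rw [compMap_eq, Category.assoc, Category.assoc, N.pi_rho, N.rho_naturality,
      reassoc_of% t.s_rho]
    rfl
  s_sigma := by
    have h2 : s.s ≫ N.sigma (Arrow.mk f) = s.s ≫ N.E.map s.sq := s.s_sigma
    have h3 : t.s ≫ N.sigma (Arrow.mk g) = t.s ≫ N.E.map t.sq := t.s_sigma
    have h4 := comp_compMap w s t
    have h5 := compMap_eq w s t
    have h7 : ∀ (k : Arrow.mk h ⟶ N.L.obj (Arrow.mk h)), compMap N w s t ≫ N.E.map k =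
        t.s ≫ N.E.map (compSq N w s) ≫ N.E.map (N.R.map k) ≫ N.pi _ := fun k => by
      rw [h5, Category.assoc, Category.assoc, N.pi_naturality]
    -- The distributive law moves `σ` past `π`; the axiom for `t` then disposes of the `σ` that
    -- appears at `g`.
    have h8 : compMap N w s t ≫ N.sigma (Arrow.mk h) = t.s ≫ N.E.map t.sq ≫
        N.E.map (N.L.map (compSq N w s)) ≫ N.E.map (Arrow.homMk
          (f := N.L.obj (N.R.obj (Arrow.mk h))) (g := N.R.obj (N.L.obj (Arrow.mk h)))
          (N.sigma _) (N.pi _) ((N.sigma_rho _).trans (N.lam_pi _).symm)) ≫ N.pi _ := by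
      rw [h5, Category.assoc, Category.assoc, N.distrib, ← reassoc_of% h3,
        ← reassoc_of% N.sigma_naturality (compSq N w s)]
    refine h8.trans (Eq.trans ?_ (h7 _).symm)
    simp only [← Category.assoc]
    congr 1
    simp only [Category.assoc]
    congr 1
    rw [← N.E.map_comp, ← N.E.map_comp, ← N.E.map_comp]
    congr 1
    ext
    · have h6 := N.sigma_naturality (rightSq w)
      change 𝟙 _ ≫ (s.s ≫ N.E.map (rightSq w)) ≫ N.sigma (Arrow.mk h) =
        (s.s ≫ N.E.map (rightSq w)) ≫ N.E.map _
      rw [Category.id_comp, Category.assoc, h6, reassoc_of% h2, Category.assoc]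
      congr 1
      apply N.map_map_eq_map_map
      · rfl
      · exact h4.symm
    · change t.s ≫ N.E.map (compSq N w s) ≫ N.pi (Arrow.mk h) = 𝟙 Z ≫ compMap N w s t
      rw [← h5, Category.id_comp]

lemma isComp_compStr {X Y Z : C} {f : X ⟶ Y} {g : Y ⟶ Z} {h : X ⟶ Z} (w : f ≫ g = h)
    (s : LStr N.toDomComonad (Arrow.mk f)) (t : LStr N.toDomComonad (Arrow.mk g)) :
    IsComp N s t (compStr w s t) :=
  ⟨w, rfl⟩

lemma IsComp.eq_compStr {X Y Z : C} {f : X ⟶ Y} {g : Y ⟶ Z} {h : X ⟶ Z}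
    {s : LStr N.toDomComonad (Arrow.mk f)} {t : LStr N.toDomComonad (Arrow.mk g)}
    {u : LStr N.toDomComonad (Arrow.mk h)} (c : IsComp N s t u) (w : f ≫ g = h) :
    u = compStr w s t :=
  LStr.ext c.2

lemma isLHom_rightSq {X Y Z : C} {f : X ⟶ Y} {g : Y ⟶ Z} {h : X ⟶ Z} (w : f ≫ g = h)
    (s : LStr N.toDomComonad (Arrow.mk f)) (t : LStr N.toDomComonad (Arrow.mk g)) :
    IsLHom s (compStr w s t) (rightSq w) :=
  comp_compMap w s t

/-- Morphisms of `L`-maps compose along composites of `L`-maps. -/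
lemma isLHom_compStr {X Y Z X' Y' Z' : C} {f : X ⟶ Y} {g : Y ⟶ Z} {h : X ⟶ Z} (w : f ≫ g = h)
    {f' : X' ⟶ Y'} {g' : Y' ⟶ Z'} {h' : X' ⟶ Z'} (w' : f' ≫ g' = h')
    {s : LStr N.toDomComonad (Arrow.mk f)} {t : LStr N.toDomComonad (Arrow.mk g)}
    {s' : LStr N.toDomComonad (Arrow.mk f')} {t' : LStr N.toDomComonad (Arrow.mk g')}
    (φ : Arrow.mk f ⟶ Arrow.mk f') (ψ : Arrow.mk g ⟶ Arrow.mk g')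
    (χ : Arrow.mk h ⟶ Arrow.mk h') (hφψ : φ.right = ψ.left) (hl : χ.left = φ.left)
    (hr : χ.right = ψ.right) (hφ : IsLHom s s' φ) (hψ : IsLHom t t' ψ) :
    IsLHom (compStr w s t) (compStr w' s' t') χ := by
  have h1 : χ.right ≫ t'.s = t.s ≫ N.E.map ψ := by rw [hr]; exact hψ
  have h2 : ψ.left ≫ s'.s = s.s ≫ N.E.map φ := by rw [← hφψ]; exact hφ
  change χ.right ≫ compMap N w' s' t' = compMap N w s t ≫ _
  rw [compMap_eq, compMap_eq, reassoc_of% h1, Category.assoc, Category.assoc, ← N.pi_naturality]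
  congr 1
  simp only [← Category.assoc]
  congr 1
  apply N.map_map_eq_map_map
  · change ψ.left ≫ s'.s ≫ N.E.map (rightSq w') = (s.s ≫ N.E.map (rightSq w)) ≫ N.E.map χ
    rw [reassoc_of% h2, Category.assoc]
    congr 1
    apply N.map_map_eq_map_map
    · change φ.left ≫ 𝟙 _ = 𝟙 _ ≫ χ.left
      rw [hl, Category.comp_id, Category.id_comp]
    · change φ.right ≫ g' = g ≫ χ.right
      rw [hr, hφψ]
      exact Arrow.w ψ
  · change ψ.right ≫ 𝟙 _ = 𝟙 _ ≫ χ.right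
    rw [hr, Category.comp_id, Category.id_comp]

/-- Naturality and associativity of `π` bring both sides to the form `r` followed by `E` of a square
and one `π`; the two squares agree by naturality of `π` once more. -/
lemma compStr_assoc {X Y Z W : C} {f : X ⟶ Y} {g : Y ⟶ Z} {k : Z ⟶ W} {fg : X ⟶ Z} {gk : Y ⟶ W}
    {fgk : X ⟶ W} (w : f ≫ g = fg) (w' : g ≫ k = gk) (v : fg ≫ k = fgk) (v' : f ≫ gk = fgk)
    (s : LStr N.toDomComonad (Arrow.mk f)) (t : LStr N.toDomComonad (Arrow.mk g))
    (r : LStr N.toDomComonad (Arrow.mk k)) :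
    compStr v (compStr w s t) r = compStr v' s (compStr w' t r) := by
  apply LStr.ext
  change compMap N v _ _ = compMap N v' _ _
  have e : (compStr w' t r).s = _ := compMap_eq w' t r
  have e' : (compStr w s t).s = _ := compMap_eq w s t
  rw [compMap_eq, compMap_eq, e, Category.assoc, Category.assoc]
  congr 1
  have h1 := N.pi_naturality (compSq N v' s)
  dsimp at h1 
  rw [← reassoc_of% h1, ← N.assoc]
  simp only [← Category.assoc]
  congr 1
  rw [← N.E.map_comp, ← N.E.map_comp]
  congr 1
  ext
  · have h2 := N.pi_naturality (rightSq v)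
    change (compStr w s t).s ≫ N.E.map (rightSq v) =
      ((t.s ≫ N.E.map (rightSq w')) ≫ N.E.map (compSq N v' s)) ≫ N.pi (Arrow.mk fgk)
    rw [e', Category.assoc, Category.assoc, Category.assoc, ← h2, Category.assoc]
    congr 1
    simp only [← Category.assoc]
    congr 1
    apply N.map_map_eq_map_map
    · change (s.s ≫ N.E.map (rightSq w)) ≫ N.E.map (rightSq v) =
        𝟙 _ ≫ s.s ≫ N.E.map (rightSq v')
      rw [Category.assoc, Category.id_comp]
      congr 1
      apply N.map_map_eq _ _ _ (Category.id_comp _) w'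
    · exact (Category.id_comp _).trans (Category.comp_id _).symm
  · change 𝟙 _ = (𝟙 _ ≫ 𝟙 _) ≫ 𝟙 _
    simp

/-- On an identity the structure map is forced to be `λ`, so the square `compSq` is the unit of the
monad and the law `unit_pi` applies. -/
lemma IsComp.of_left_id {X Z : C} {f : X ⟶ X} {g : X ⟶ Z} (hf : f = 𝟙 X)
    (s : LStr N.toDomComonad (Arrow.mk f)) (t : LStr N.toDomComonad (Arrow.mk g)) :
    IsComp N s t t := by
  subst hf
  refine ⟨Category.id_comp g, ?_⟩
  have h1 : 𝟙 X ≫ s.s = N.lam (Arrow.mk (𝟙 X)) := s.hom_s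
  rw [Category.id_comp] at h1
  have h2 : compSq N (Category.id_comp g) s = N.unit (Arrow.mk g) := by
    ext
    · change s.s ≫ N.E.map (rightSq (Category.id_comp g)) = N.lam (Arrow.mk g)
      rw [h1, ← N.lam_naturality]
      exact Category.id_comp _
    · rfl
  rw [compMap_eq, h2, N.unit_pi, Category.comp_id]

lemma IsComp.of_right_id {X Z : C} {f : X ⟶ Z} {g : Z ⟶ Z} (hg : g = 𝟙 Z)
    (s : LStr N.toDomComonad (Arrow.mk f)) (t : LStr N.toDomComonad (Arrow.mk g)) :
    IsComp N s t s := by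
  subst hg
  refine ⟨Category.comp_id f, ?_⟩
  have h1 := comp_compMap (Category.comp_id f) s t
  rw [Category.id_comp] at h1
  rw [h1]
  have h2 : rightSq (Category.comp_id f) = 𝟙 (Arrow.mk f) := by ext <;> rfl
  rw [h2, N.E.map_id, Category.comp_id]

end Composition


/-! ### Unique recursion along a well-order -/

/-- A family over a well-order is uniquely determined by a specification which, at each stage,
determines the value in terms of the previous values. -/
theorem existsUnique_of_wellFoundedLT {K : Type*} [LinearOrder K] [WellFoundedLT K] {T : K → Type*}
    (Spec : ∀ y, (∀ z, z < y → T z) → T y → Prop)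
    (H : ∀ (y) (prev : ∀ z, z < y → T z),
      (∀ z hz, Spec z (fun x hx => prev x (hx.trans hz)) (prev z hz)) → ∃! a, Spec y prev a) :
    ∃! f : ∀ y, T y, ∀ y, Spec y (fun z _ => f z) (f y) := by
  classical
  -- A value need exist only when the earlier values satisfy the specification, which is unknown
  -- during the recursion. The recursion therefore takes values in `Option`, and `key` shows
  -- afterwards that `none` never occurs.
  let step : ∀ y, (∀ z, z < y → Option (T z)) → Option (T y) := fun y rec =>
    if h : ∃ (hs : ∀ z hz, (rec z hz).isSome) (a : T y),
      Spec y (fun z hz => (rec z hz).get (hs z hz)) a then some h.choose_spec.choose else none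
  let val : ∀ y, Option (T y) := fun y => WellFoundedLT.fix step y
  have val_eq : ∀ y, val y = step y (fun z _ => val z) := fun y => WellFoundedLT.fix_eq step y
  have key : ∀ y, (val y).isSome ∧ ∀ hs : ∀ z, z ≤ y → (val z).isSome,
      Spec y (fun z hz => (val z).get (hs z hz.le)) ((val y).get (hs y le_rfl)) := by
    intro y
    induction y using WellFoundedLT.induction with
    | ind y ih =>
      have hs : ∀ z, z < y → (val z).isSome := fun z hz => (ih z hz).1
      obtain ⟨a, ha, -⟩ := H y (fun z hz => (val z).get (hs z hz))
        (fun z hz => (ih z hz).2 (fun x hx => hs x (hx.trans_lt hz)))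
      have hex : ∃ (hs : ∀ z, z < y → (val z).isSome) (a : T y),
        Spec y (fun z hz => (val z).get (hs z hz)) a := ⟨hs, a, ha⟩
      have e : val y = some hex.choose_spec.choose := (val_eq y).trans (dif_pos hex)
      refine ⟨by rw [e]; rfl, fun hs' => ?_⟩
      have e' : (val y).get (hs' y le_rfl) = hex.choose_spec.choose :=
        Option.get_of_eq_some _ e
      rw [e']
      exact hex.choose_spec.choose_spec
  refine ⟨fun y => (val y).get (key y).1, fun y => (key y).2 (fun z _ => (key z).1), ?_⟩
  intro f hf
  funext y
  induction y using WellFoundedLT.induction with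
  | ind y ih =>
    have h1 := hf y
    have e : (fun z (_ : z < y) => f z) = fun z _ => (val z).get (key z).1 := by
      funext z hz
      exact ih z hz
    rw [e] at h1
    exact (H y _ (fun z _ => (key z).2 (fun z _ => (key z).1))).unique h1
      ((key y).2 (fun z _ => (key z).1))

/-! ### Attaching cells -/

section Attach

open HomotopicalAlgebra

variable {ι : Type w} {J : ι → Arrow C} {N : NWFS C} (α : ∀ i, LStr N.toDomComonad (J i))

/-- The inclusion of a summand in a coproduct of members of `J`. -/
abbrev cellSq {X Y : C} {f : X ⟶ Y} (c : AttachCells.{w} (fun i => (J i).hom) f) (k : c.ι) :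
    J (c.π k) ⟶ Arrow.mk c.m :=
  Arrow.homMk (f := J (c.π k)) (g := Arrow.mk c.m) (c.cofan₁.inj k) (c.cofan₂.inj k) (c.hm k)

/-- The pushout square of a map obtained by attaching cells. -/
abbrev pushoutSq {X Y : C} {f : X ⟶ Y} (c : AttachCells.{w} (fun i => (J i).hom) f) :
    Arrow.mk c.m ⟶ Arrow.mk f :=
  Arrow.homMk (f := Arrow.mk c.m) (g := Arrow.mk f) c.g₁ c.g₂ c.isPushout.w

/-- Coproduct inclusions are jointly epic on codomains, and a pushout square is epic on codomains
relative to the pushed-out map. Each of the two universal properties produces a structure map, and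
joint epicness supplies the axioms and uniqueness. -/
lemma existsUnique_isAttachStr {X Y : C} {f : X ⟶ Y}
    (c : AttachCells.{w} (fun i => (J i).hom) f) :
    ∃! s : LStr N.toDomComonad (Arrow.mk f), IsAttachStr α c s := by
  have h₁ : JointlyEpi (cellSq c) := fun Z a b _ h => Cofan.IsColimit.hom_ext c.isColimit₂ _ _ h
  have h₂ : JointlyEpi (K := Unit) (fun _ => pushoutSq c) := fun Z a b h h' =>
    c.isPushout.hom_ext h (h' ())
  let m : LStr N.toDomComonad (Arrow.mk c.m) := LStr.ofJointlyEpi h₁ (fun k => α (c.π k))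
    (Cofan.IsColimit.desc c.isColimit₂ fun k => (α (c.π k)).s ≫ N.E.map (cellSq c k))
    (Cofan.IsColimit.hom_ext c.isColimit₁ _ _ fun k => by
      change c.cofan₁.inj k ≫ c.m ≫ _ = _
      rw [c.hm_assoc, Cofan.IsColimit.fac, reassoc_of% (α (c.π k)).hom_s, ← N.lam_naturality]
      rfl)
    (fun k => Cofan.IsColimit.fac _ _ _)
  have hm : ∀ k, IsLHom (α (c.π k)) m (cellSq c k) := fun k => Cofan.IsColimit.fac _ _ _
  have hw : c.g₁ ≫ N.lam (Arrow.mk f) = c.m ≫ m.s ≫ N.E.map (pushoutSq c) := by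
    have e : c.m ≫ m.s = N.lam (Arrow.mk c.m) := m.hom_s
    rw [reassoc_of% e, ← N.lam_naturality]
    rfl
  let s : LStr N.toDomComonad (Arrow.mk f) := LStr.ofJointlyEpi h₂ (fun _ => m)
    (c.isPushout.desc (N.lam (Arrow.mk f)) (m.s ≫ N.E.map (pushoutSq c)) hw)
    (c.isPushout.inl_desc _ _ _) (fun _ => c.isPushout.inr_desc _ _ _)
  refine ⟨s, ⟨m, hm, c.isPushout.inr_desc _ _ _⟩, ?_⟩
  rintro s' ⟨m', hm', hs'⟩
  obtain rfl : m' = m := LStr.ext_of_jointlyEpi h₁ hm' hm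
  exact LStr.ext_of_jointlyEpi h₂ (t := fun _ => m) (fun _ => hs')
    (fun _ => c.isPushout.inr_desc _ _ _)

end Attach


/-! ### Transfinite composites of `L`-maps -/

section Chain

variable {N : NWFS C}

lemma chain_w {K : Type*} [Preorder K] (F : K ⥤ C) {x y z : K} (h : x ≤ y) (h' : y ≤ z) :
    F.map (homOfLE h) ≫ F.map (homOfLE h') = F.map (homOfLE (h.trans h')) := by
  rw [← F.map_comp]
  rfl

lemma map_eq_id {K : Type*} [Preorder K] {x : K} (F : K ⥤ C) (h : x ≤ x) : F.map (homOfLE h) = 𝟙 (F.obj x) :=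
  F.map_id x

/-- `L`-map structures on the maps of a chain starting at a given object, compatible with each
other, induce a unique compatible `L`-map structure on the leg of a colimit cocone. -/
lemma existsUnique_isLHom_colimit {I : Type*} [LinearOrder I] {G : I ⥤ C} {cc : Cocone G}
    (hc : IsColimit cc) (x : I)
    (t : ∀ z (hz : x ≤ z), LStr N.toDomComonad (Arrow.mk (G.map (homOfLE hz))))
    (w : ∀ {z z'} (hz : x ≤ z) (hz' : z ≤ z'), G.map (homOfLE hz) ≫ G.map (homOfLE hz') =
      G.map (homOfLE (hz.trans hz')))
    (ht : ∀ {z z'} (hz : x ≤ z) (hz' : z ≤ z'),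
      IsLHom (t z hz) (t z' (hz.trans hz')) (rightSq (w hz hz'))) :
    ∃! u : LStr N.toDomComonad (Arrow.mk (cc.ι.app x)),
      ∀ z (hz : x ≤ z), IsLHom (t z hz) u (rightSq (cc.w (homOfLE hz))) := by
  have hepi : JointlyEpi (K := {z // x ≤ z})
      (fun z => rightSq (cc.w (homOfLE z.2)) : ∀ z : {z // x ≤ z}, Arrow.mk (G.map (homOfLE z.2)) ⟶
        Arrow.mk (cc.ι.app x)) := by
    intro Z a b _ h
    refine hc.hom_ext fun z => ?_
    -- Legs at stages not above `x` factor through the leg at `max x z`. The cocone defining `d`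
    -- below is extended to all stages in the same way.
    have := h ⟨max x z, le_max_left _ _⟩
    change cc.ι.app _ ≫ a = cc.ι.app _ ≫ b at this
    rw [← cc.w (homOfLE (le_max_right x z)), Category.assoc, Category.assoc, this]
  let leg : ∀ z (hz : x ≤ z), G.obj z ⟶ N.E.obj (Arrow.mk (cc.ι.app x)) := fun z hz =>
    (t z hz).s ≫ N.E.map (rightSq (cc.w (homOfLE hz)))
  have hleg : ∀ {z z'} (hz : x ≤ z) (hz' : z ≤ z'),
      G.map (homOfLE hz') ≫ leg z' (hz.trans hz') = leg z hz := by
    intro z z' hz hz'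
    have := ht hz hz'
    change G.map (homOfLE hz') ≫ (t z' _).s = (t z hz).s ≫ N.E.map _ at this
    dsimp only [leg]
    rw [reassoc_of% this, N.map_map_eq]
    · exact Category.id_comp _
    · exact cc.w _
  let d : cc.pt ⟶ N.E.obj (Arrow.mk (cc.ι.app x)) := hc.desc
    { pt := _
      ι :=
        { app := fun z => G.map (homOfLE (le_max_right x z)) ≫ leg (max x z) (le_max_left _ _)
          naturality := fun z z' f => by
            dsimp only [Functor.const_obj_obj, Functor.const_obj_map]
            rw [Category.comp_id, ← hleg (le_max_left x z) (max_le_max le_rfl (leOfHom f)),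
              ← G.map_comp_assoc, ← G.map_comp_assoc]
            rfl } }
  have hd : ∀ z (hz : x ≤ z), cc.ι.app z ≫ d = leg z hz := by
    intro z hz
    rw [hc.fac]
    exact hleg hz _
  refine ⟨LStr.ofJointlyEpi hepi (fun z => t z.1 z.2) d ?_ (fun z => hd z.1 z.2),
    fun z hz => hd z hz, fun u hu => LStr.ext_of_jointlyEpi hepi (t := fun z => t z.1 z.2)
      (fun z => hu z.1 z.2) (fun z => hd z.1 z.2)⟩
  -- The unit condition is read off at the stage `x` itself, where the connecting map is an
  -- identity.
  have h1 : G.map (homOfLE le_rfl) ≫ (t x le_rfl).s =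
      N.lam (Arrow.mk (G.map (homOfLE (le_refl x)))) := (t x le_rfl).hom_s
  have h2 : G.map (homOfLE (le_refl x)) = 𝟙 _ := G.map_id x
  change cc.ι.app x ≫ d = _
  rw [hd x le_rfl, ← Category.id_comp (leg x le_rfl), ← h2, reassoc_of% h1, ← N.lam_naturality]
  exact Category.id_comp _

end Chain

section Tower

open HomotopicalAlgebra

variable {ι : Type w} {J : ι → Arrow C} {N : NWFS C} (α : ∀ i, LStr N.toDomComonad (J i))
  {K : Type w} [LinearOrder K] [OrderBot K] [SuccOrder K] [WellFoundedLT K] {X Y : C} {g : X ⟶ Y}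
  (c : RelativeCellComplex.{w} (fun (_ : K) i => (J i).hom) g)

/-- The structure of the step from `z` to its successor `y`. -/
noncomputable def attachStr {z y : K} (hz : ¬ IsMax z) (e : y = Order.succ z) (h : z ≤ y) :
    LStr N.toDomComonad (Arrow.mk (c.F.map (homOfLE h))) := by
  subst e
  exact (existsUnique_isAttachStr α (c.attachCells z hz)).choose

lemma isAttachStr_attachStr {z : K} (hz : ¬ IsMax z) :
    IsAttachStr α (c.attachCells z hz) (attachStr α c hz rfl (Order.le_succ z)) :=
  (existsUnique_isAttachStr α (c.attachCells z hz)).choose_spec.1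

lemma eq_attachStr {z : K} (hz : ¬ IsMax z)
    {s : LStr N.toDomComonad (Arrow.mk (c.F.map (homOfLE (Order.le_succ z))))}
    (hs : IsAttachStr α (c.attachCells z hz) s) : s = attachStr α c hz rfl (Order.le_succ z) :=
  (existsUnique_isAttachStr α (c.attachCells z hz)).unique hs (isAttachStr_attachStr α c hz)

variable (N) in
/-- `L`-map structures on the map from stage `x` to stage `y`. -/
abbrev StageStr (F : K ⥤ C) (x y : K) : Type _ :=
  ∀ h : x ≤ y, LStr N.toDomComonad (Arrow.mk (F.map (homOfLE h)))

/-- The specification of the structure of the map from stage `x` to stage `y` in terms of those to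
the previous stages. -/
def StageSpec (x y : K) (prev : ∀ z, z < y → StageStr N c.F x z) (u : StageStr N c.F x y) : Prop :=
  ∀ h : x ≤ y,
    (∀ z (hz : x ≤ z) (zy : z < y),
      IsLHom (prev z zy hz) (u h) (rightSq (chain_w c.F hz zy.le))) ∧
    ∀ z (hz : x ≤ z) (nm : ¬ IsMax z) (e : y = Order.succ z) (zy : z < y),
      IsComp N (prev z zy hz) (attachStr α c nm e zy.le) (u h)

/-- The specification asks for compatibility with all earlier stages and for the prescribed
composite at a successor. At `y = x` the map is an isomorphism and has a single structure; at a
limit, compatibility determines the structure on the colimit; at a successor the composite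
determines it and compatibility follows from `isLHom_rightSq`. -/
lemma existsUnique_stageSpec (x y : K) (prev : ∀ z, z < y → StageStr N c.F x z)
    (hprev : ∀ z hz, StageSpec α c x z (fun v hv => prev v (hv.trans hz)) (prev z hz)) :
    ∃! u, StageSpec α c x y prev u := by
  by_cases hxy : x ≤ y
  swap
  · exact ⟨fun h => (hxy h).elim, fun h => (hxy h).elim, fun u _ => funext fun h => (hxy h).elim⟩
  suffices H : ∃! u : LStr N.toDomComonad (Arrow.mk (c.F.map (homOfLE hxy))),
      (∀ z (hz : x ≤ z) (zy : z < y),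
        IsLHom (prev z zy hz) u (rightSq (chain_w c.F hz zy.le))) ∧
      ∀ z (hz : x ≤ z) (nm : ¬ IsMax z) (e : y = Order.succ z) (zy : z < y),
        IsComp N (prev z zy hz) (attachStr α c nm e zy.le) u by
    obtain ⟨u, hu, hu'⟩ := H
    exact ⟨fun _ => u, fun _ => hu, fun v hv => funext fun h => hu' _ (hv h)⟩
  obtain rfl | hlt := hxy.eq_or_lt
  · have : IsIso (Arrow.mk (c.F.map (homOfLE hxy))).hom := by
      change IsIso (c.F.map (𝟙 x))
      infer_instance
    exact ⟨LStr.ofIsIso _ _, ⟨fun z hz zy => (zy.not_ge hz).elim,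
      fun z hz _ _ zy => (zy.not_ge hz).elim⟩, fun u _ => LStr.eq_of_isIso _ _⟩
  have hom_prev : ∀ {z z'} (hz : x ≤ z) (zz' : z ≤ z') (hz' : z' < y),
      IsLHom (prev z (zz'.trans_lt hz') hz) (prev z' hz' (hz.trans zz'))
        (rightSq (chain_w c.F hz zz')) := by
    intro z z' hz zz' hz'
    obtain rfl | hlt := zz'.eq_or_lt
    · have e : rightSq (chain_w c.F hz zz') = 𝟙 (Arrow.mk (c.F.map (homOfLE hz))) := by
        ext
        · rfl
        · exact c.F.map_id z
      have := IsLHom.id (prev z hz' hz)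
      rw [← e] at this
      exact this
    · exact (hprev z' hz' (hz.trans zz')).1 z hz hlt
  by_cases hy : Order.IsSuccPrelimit y
  · have hlim : Order.IsSuccLimit y := ⟨fun h => (h hlt.le).not_gt hlt, hy⟩
    obtain ⟨u, hu, hu'⟩ := existsUnique_isLHom_colimit (N := N)
      (c.F.isColimitOfIsWellOrderContinuous y hlim) (⟨x, hlt⟩ : Set.Iio y)
      (fun z hz => prev z.1 z.2 hz) (fun {z z'} hz hz' => chain_w c.F hz hz')
      (fun {z z'} hz hz' => hom_prev hz hz' z'.2)
    refine ⟨u, ⟨fun z hz zy => hu ⟨z, zy⟩ hz, fun z _ nm e zy => ?_⟩,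
      fun v hv => hu' v (fun z hz => hv.1 z.1 hz z.2)⟩
    -- A limit stage is not a successor, so the composition clause is vacuous here.
    exact (hy z (e ▸ Order.covBy_succ_of_not_isMax nm)).elim
  · obtain ⟨z, nm, rfl⟩ : ∃ z, ¬ IsMax z ∧ Order.succ z = y := by
      simp only [Order.IsSuccPrelimit, not_forall, not_not] at hy
      obtain ⟨z, hz⟩ := hy
      exact ⟨z, hz.lt.not_isMax, hz.succ_eq⟩
    have zy := Order.lt_succ_of_not_isMax nm
    have hxz : x ≤ z := (Order.lt_succ_iff_of_not_isMax nm).1 hlt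
    have hz' : ∀ z', ¬ IsMax z' → Order.succ z = Order.succ z' → z' = z := fun z' nm' e =>
      ((Order.succ_eq_succ_iff_of_not_isMax nm nm').1 e).symm
    refine ⟨compStr (chain_w c.F hxz zy.le) (prev z zy hxz) (attachStr α c nm rfl zy.le),
      ⟨fun v hv vy => ?_, fun z' hz nm' e zy' => ?_⟩,
      fun u hu => (hu.2 z hxz nm rfl zy).eq_compStr _⟩
    · have h1 := (hom_prev hv ((Order.lt_succ_iff_of_not_isMax nm).1 vy) zy).comp
        (isLHom_rightSq (chain_w c.F hxz zy.le) (prev z zy hxz) (attachStr α c nm rfl zy.le))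
      convert h1 using 1
      ext
      · exact (Category.id_comp _).symm
      · exact (chain_w c.F _ _).symm
    · obtain rfl := hz' z' nm' e
      exact isComp_compStr _ _ _

lemma existsUnique_stages (x : K) :
    ∃! f : ∀ y, StageStr N c.F x y, ∀ y, StageSpec α c x y (fun z _ => f z) (f y) :=
  existsUnique_of_wellFoundedLT _ (existsUnique_stageSpec α c x)

/-- The induced structure on the map between two stages. -/
noncomputable def stageStr {x y : K} (h : x ≤ y) :
    LStr N.toDomComonad (Arrow.mk (c.F.map (homOfLE h))) :=
  (existsUnique_stages α c x).choose y h

lemma stageSpec_stageStr (x y : K) :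
    StageSpec α c x y (fun _ _ hz => stageStr α c hz) (fun h => stageStr α c h) :=
  (existsUnique_stages α c x).choose_spec.1 y

lemma eq_stageStr {x : K} {f : ∀ y, StageStr N c.F x y}
    (hf : ∀ y, StageSpec α c x y (fun z _ => f z) (f y)) {y : K} (h : x ≤ y) :
    f y h = stageStr α c h := by
  rw [(existsUnique_stages α c x).choose_spec.2 f hf]
  rfl

lemma eq_stageStr_of_stageSpec {x y : K} (u : StageStr N c.F x y)
    (hu : StageSpec α c x y (fun _ _ hz => stageStr α c hz) u) (h : x ≤ y) :
    u h = stageStr α c h := by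
  have := (existsUnique_stageSpec α c x y _ (fun z _ => stageSpec_stageStr α c x z)).unique hu
    (stageSpec_stageStr α c x y)
  exact congrFun this h

lemma isLHom_stageStr {x z y : K} (h : x ≤ z) (h' : z ≤ y) :
    IsLHom (stageStr α c h) (stageStr α c (h.trans h')) (rightSq (chain_w c.F h h')) := by
  obtain rfl | hlt := h'.eq_or_lt
  · have e : rightSq (chain_w c.F h h') = 𝟙 (Arrow.mk (c.F.map (homOfLE h))) := by
      ext
      · rfl
      · exact c.F.map_id z
    have := IsLHom.id (stageStr α c h)
    rw [← e] at this
    exact this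
  · exact (stageSpec_stageStr α c x y (h.trans h')).1 z h hlt

/-- By induction on `d`, the composite of the structures `a → b` and `b → d` satisfies the
specification that characterises the structure `a → d`. -/
lemma isComp_stageStr {a b : K} (hab : a ≤ b) (d : K) (hbd : b ≤ d) :
    IsComp N (stageStr α c hab) (stageStr α c hbd) (stageStr α c (hab.trans hbd)) := by
  induction d using WellFoundedLT.induction with
  | ind d ih =>
    obtain rfl | hlt := hbd.eq_or_lt
    · exact IsComp.of_right_id (map_eq_id c.F hbd) _ _
    · refine ⟨chain_w c.F hab hbd, ?_⟩
      have hu : StageSpec α c a d (fun _ _ hz => stageStr α c hz)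
          (fun _ => compStr (chain_w c.F hab hbd) (stageStr α c hab) (stageStr α c hbd)) := by
        intro had
        refine ⟨fun z hz zd => ?_, fun z hz nm e zd => ?_⟩
        · obtain hzb | hbz := le_total z b
          · have h1 := (isLHom_stageStr α c hz hzb).comp
              (isLHom_rightSq (chain_w c.F hab hbd) (stageStr α c hab) (stageStr α c hbd))
            convert h1 using 1
            ext
            · exact (Category.id_comp _).symm
            · exact (chain_w c.F _ _).symm
          · dsimp only
            rw [(ih z zd hbz).eq_compStr (chain_w c.F hab hbz)]
            exact isLHom_compStr _ _ (𝟙 _) (rightSq (chain_w c.F hbz zd.le)) _ rfl rfl rfl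
              (IsLHom.id _) (isLHom_stageStr α c hbz zd.le)
        · subst e
          have hbz : b ≤ z := (Order.lt_succ_iff_of_not_isMax nm).1 hlt
          have h2 := ((stageSpec_stageStr α c b (Order.succ z) hbd).2 z hbz nm rfl zd).eq_compStr
            (chain_w c.F hbz zd.le)
          dsimp only at h2 ⊢
          -- At a successor, associativity of composition reduces the claim to the composite already
          -- known at `z`.
          rw [(ih z zd hbz).eq_compStr (chain_w c.F hab hbz), h2,
            ← compStr_assoc (chain_w c.F hab hbz) (chain_w c.F hbz zd.le) (chain_w c.F _ zd.le)]
          exact isComp_compStr _ _ _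
      exact congrArg LStr.s (eq_stageStr_of_stageSpec α c _ hu (hab.trans hbd)).symm

/-- The induced structures on the maps from the stages to the colimit. -/
lemma existsUnique_totalStr (x : K) :
    ∃! u : LStr N.toDomComonad (Arrow.mk (Y := Y) (c.incl.app x)),
      ∀ z (hz : x ≤ z), IsLHom (stageStr α c hz) u
        (rightSq ((Cocone.mk Y c.incl).w (homOfLE hz))) :=
  existsUnique_isLHom_colimit (cc := Cocone.mk Y c.incl) c.isColimit x
    (fun _ hz => stageStr α c hz) (fun hz hz' => chain_w c.F hz hz')
    (fun hz hz' => isLHom_stageStr α c hz hz')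

/-- The induced structure on the map from a stage to the colimit. -/
noncomputable def totalStr (x : K) :
    LStr N.toDomComonad (Arrow.mk (Y := Y) (c.incl.app x)) :=
  (existsUnique_totalStr α c x).choose

lemma isLHom_totalStr {x z : K} (hz : x ≤ z) :
    IsLHom (stageStr α c hz) (totalStr α c x)
      (rightSq ((Cocone.mk Y c.incl).w (homOfLE hz))) :=
  (existsUnique_totalStr α c x).choose_spec.1 z hz

lemma eq_totalStr {x : K} {u : LStr N.toDomComonad (Arrow.mk (Y := Y) (c.incl.app x))}
    (hu : ∀ z (hz : x ≤ z), IsLHom (stageStr α c hz) u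
      (rightSq ((Cocone.mk Y c.incl).w (homOfLE hz)))) : u = totalStr α c x :=
  (existsUnique_totalStr α c x).choose_spec.2 u hu

lemma isComp_totalStr {a b : K} (hab : a ≤ b) :
    IsComp N (stageStr α c hab) (totalStr α c b) (totalStr α c a) := by
  have w := (Cocone.mk Y c.incl).w (homOfLE hab)
  refine ⟨w, ?_⟩
  -- As for stages: the composite is compatible with every stage above `a`, and only one structure
  -- on the leg is.
  have h : compStr w (stageStr α c hab) (totalStr α c b) = totalStr α c a := by
    apply eq_totalStr
    intro z hz
    obtain hzb | hbz := le_total z b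
    · have h1 := (isLHom_stageStr α c hz hzb).comp
        (isLHom_rightSq w (stageStr α c hab) (totalStr α c b))
      convert h1 using 1
      ext
      · exact (Category.id_comp _).symm
      · exact ((Cocone.mk Y c.incl).w (homOfLE hzb)).symm
    · rw [(isComp_stageStr α c hab z hbz).eq_compStr (chain_w c.F hab hbz)]
      exact isLHom_compStr _ _ (𝟙 _) (rightSq ((Cocone.mk Y c.incl).w (homOfLE hbz))) _ rfl rfl rfl
        (IsLHom.id _) (isLHom_totalStr α c hbz)
  exact congrArg LStr.s h.symm

/-- The comparison of the map from the initial stage with the transfinite composite. -/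
abbrev botSq : Arrow.mk (Y := Y) (c.incl.app ⊥) ⟶ Arrow.mk g :=
  Arrow.homMk (f := Arrow.mk (Y := Y) (c.incl.app ⊥)) (g := Arrow.mk g) c.isoBot.hom (𝟙 Y)
    (((congrArg (fun k => c.isoBot.hom ≫ k) c.fac.symm).trans
      (Iso.hom_inv_id_assoc _ _)).trans (Category.comp_id _).symm)

/-- A transfinite composite of pushouts of coproducts of generating cofibrations has exactly one
`L`-map structure making it a transfinite composite of `L`-maps. -/
theorem existsUnique_isCellStr :
    ∃! s : LStr N.toDomComonad (Arrow.mk g), IsCellStr α c s := by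
  have : IsIso (botSq c) := by
    have : IsIso (botSq c).left := inferInstanceAs (IsIso c.isoBot.hom)
    have : IsIso (botSq c).right := inferInstanceAs (IsIso (𝟙 Y))
    exact Arrow.isIso_of_isIso_left_of_isIso_right _
  obtain ⟨s, hs, hs'⟩ := existsUnique_isLHom_of_isIso (botSq c) (totalStr α c ⊥)
  refine ⟨s, ⟨fun h => stageStr α c h, totalStr α c, fun h h' => isComp_stageStr α c h _ h',
    fun h => isComp_totalStr α c h, fun a ha => ?_, hs⟩, ?_⟩
  · have h1 := (stageSpec_stageStr α c a (Order.succ a) (Order.le_succ a)).2 a le_rfl ha rfl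
      (Order.lt_succ_of_not_isMax ha)
    -- The recursion gives the first step as a composite with the structure on an identity, which is
    -- neutral; so it is exactly the structure of the attached cells.
    have h2 := IsComp.of_left_id (map_eq_id c.F le_rfl) (stageStr α c (le_refl a))
      (attachStr α c ha rfl (Order.le_succ a))
    have h3 : stageStr α c (Order.le_succ a) = attachStr α c ha rfl (Order.le_succ a) :=
      LStr.ext (h1.2.trans h2.2.symm)
    dsimp only
    rw [h3]
    exact isAttachStr_attachStr α c ha
  · rintro s' ⟨str, tot, hstr, htot, hatt, hs₁⟩
    have e : ∀ {x y : K} (h : x ≤ y), str h = stageStr α c h := by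
      intro x y h
      -- Any lifted chain satisfies the recursive specification: compatibility holds since the first
      -- factor always maps to a composite.
      refine eq_stageStr α c (x := x) (f := fun y h => str h) (fun y h => ⟨fun z hz zy => ?_,
        fun z hz nm e zy => ?_⟩) h
      · dsimp only
        rw [(hstr hz zy.le).eq_compStr (chain_w c.F hz zy.le)]
        exact isLHom_rightSq _ _ _
      · subst e
        rw [← eq_attachStr α c nm (hatt z nm)]
        exact hstr _ _
    have e' : ∀ x, tot x = totalStr α c x := by
      intro x
      refine eq_totalStr α c fun z hz => ?_
      rw [← e hz, (htot hz).eq_compStr ((Cocone.mk Y c.incl).w (homOfLE hz))]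
      exact isLHom_rightSq _ _ _
    rw [e'] at hs₁
    exact hs' s' hs₁

end Tower


/-! ### Iterating a successor structure along all ordinals -/

section Iteration

open SmallObject Functor

variable {D : Type*} [Category.{w} D]

/-- The embedding of `D` in a category with large colimits which preserves colimits. -/
abbrev bigEmbedding (D : Type*) [Category.{w} D] : D ⥤ (D ⥤ Type (w + 1))ᵒᵖ :=
  (uliftCoyoneda.{w + 1} (C := D)).rightOp

/-- `uliftCoyoneda` sends limits of `Dᵒᵖ` to limits of functors; passing to opposites makes these
colimits. -/
instance : PreservesColimitsOfSize.{w + 1, w + 1} (bigEmbedding D) :=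
  preservesColimitsOfSize_rightOp _

open Classical in
/-- The extension of the successor of a successor structure along `bigEmbedding`. -/
noncomputable def bigSucc (Φ : SuccStruct D) (X : (D ⥤ Type (w + 1))ᵒᵖ) : (D ⥤ Type (w + 1))ᵒᵖ :=
  if h : (bigEmbedding D).essImage X then (bigEmbedding D).obj (Φ.succ h.witness) else X

lemma bigSucc_eq (Φ : SuccStruct D) {X : (D ⥤ Type (w + 1))ᵒᵖ} (h : (bigEmbedding D).essImage X) :
    bigSucc Φ X = (bigEmbedding D).obj (Φ.succ h.witness) := dif_pos h

open Classical in
/-- The extension of a successor structure along `bigEmbedding`. -/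
noncomputable def bigSuccStruct (Φ : SuccStruct D) : SuccStruct (D ⥤ Type (w + 1))ᵒᵖ where
  X₀ := (bigEmbedding D).obj Φ.X₀
  succ := bigSucc Φ
  toSucc X := if h : (bigEmbedding D).essImage X
    then h.getIso.inv ≫ (bigEmbedding D).map (Φ.toSucc h.witness) ≫ eqToHom (bigSucc_eq Φ h).symm
    else eqToHom (by rw [bigSucc, dif_neg h])

lemma bigSuccStruct_toSucc (Φ : SuccStruct D) {X : (D ⥤ Type (w + 1))ᵒᵖ}
    (h : (bigEmbedding D).essImage X) :
    (bigSuccStruct Φ).toSucc X = h.getIso.inv ≫ (bigEmbedding D).map (Φ.toSucc h.witness) ≫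
      eqToHom (bigSucc_eq Φ h).symm := dif_pos h

/-- A successor structure can be iterated along all ordinals. -/
theorem exists_iteration (hD : ∀ o : Ordinal.{w}, HasColimitsOfShape (Set.Iio o) D)
    (Φ : SuccStruct D) :
    ∃ G : Ordinal.{w} ⥤ D, G.IsWellOrderContinuous ∧ Nonempty (G.obj ⊥ ≅ Φ.X₀) ∧
      ∀ o, ∃ e : G.obj (Order.succ o) ≅ Φ.succ (G.obj o),
        G.map (homOfLE (Order.le_succ o)) = Φ.toSucc (G.obj o) ≫ e.inv := by
  -- `Ordinal.{w}` lies in universe `w + 1`, too large for colimits in `D`. The iteration runs in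
  -- the large category, and every stage stays in the essential image because only colimits over
  -- initial segments, which `D` has, are ever taken.
  let Ψ := bigSuccStruct Φ
  let y := bigEmbedding D
  let F := Ψ.iterationFunctor Ordinal.{w}
  have mem : ∀ o, y.essImage (F.obj o) := by
    intro o
    induction o using SuccOrder.limitRecOn with
    | isMin o ho =>
      obtain rfl := ho.eq_bot
      exact ⟨Φ.X₀, ⟨(Ψ.iterationFunctorObjBotIso Ordinal.{w}).symm⟩⟩
    | succ o ho h =>
      exact ⟨Φ.succ h.witness, ⟨eqToIso (bigSucc_eq Φ h).symm ≪≫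
        (Ψ.iterationFunctorObjSuccIso o ho).symm⟩⟩
    | isSuccLimit o ho h =>
      let H : Set.Iio o ⥤ _ := (Set.principalSegIio o).monotone.functor ⋙ F
      have hH : ∀ x, y.essImage (H.obj x) := fun x => h x.1 x.2
      let H' := essImage.liftFunctor H y hH
      let e : H' ⋙ y ≅ H := essImage.liftFunctorCompIso H y hH
      have := hD o
      have h1 := isColimitOfPreserves y (colimit.isColimit H')
      have h2 := F.isColimitOfIsWellOrderContinuous o ho
      exact ⟨colimit H', ⟨h1.coconePointsIsoOfNatIso h2 e⟩⟩
  -- Full faithfulness transports the chain back to `D`; its colimits are reflected.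
  let G : Ordinal.{w} ⥤ D :=
    { obj := fun o => (mem o).witness
      map := fun {o o'} f => y.preimage ((mem o).getIso.hom ≫ F.map f ≫ (mem o').getIso.inv)
      map_id := fun o => y.map_injective (by simp)
      map_comp := fun f g => y.map_injective (by simp) }
  let e : G ⋙ y ≅ F := NatIso.ofComponents (fun o => (mem o).getIso)
    (fun f => by simp [G])
  have : (G ⋙ y).IsWellOrderContinuous := isWellOrderContinuous_of_iso e.symm
  refine ⟨G, ⟨fun o ho => ?_⟩, ?_, fun o => ?_⟩
  · have h := (G ⋙ y).isColimitOfIsWellOrderContinuous o ho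
    exact ⟨isColimitOfReflects y h⟩
  · exact ⟨y.preimageIso (e.app ⊥ ≪≫ Ψ.iterationFunctorObjBotIso Ordinal.{w})⟩
  · have ho : ¬ IsMax o := not_isMax o
    let i : y.obj (G.obj (Order.succ o)) ≅ y.obj (Φ.succ (G.obj o)) :=
      e.app _ ≪≫ Ψ.iterationFunctorObjSuccIso o ho ≪≫ eqToIso (bigSucc_eq Φ (mem o))
    refine ⟨y.preimageIso i, y.map_injective ?_⟩
    have h1 := Ψ.iterationFunctor_map_succ o ho
    have h2 := e.hom.naturality (homOfLE (Order.le_succ o))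
    rw [← cancel_mono (e.hom.app _)]
    refine h2.trans ?_
    have h3 : F.map (homOfLE (Order.le_succ o)) = (mem o).getIso.inv ≫
        y.map (Φ.toSucc (G.obj o)) ≫ i.inv ≫ e.hom.app (Order.succ o) := by
      have h4 : i.inv ≫ e.hom.app (Order.succ o) = eqToHom (bigSucc_eq Φ (mem o)).symm ≫
          (Ψ.iterationFunctorObjSuccIso o ho).inv := by
        have h6 : e.inv.app (Order.succ o) ≫ e.hom.app (Order.succ o) = 𝟙 _ :=
          e.inv_hom_id_app _
        change ((eqToHom (bigSucc_eq Φ (mem o)).symm ≫ (Ψ.iterationFunctorObjSuccIso o ho).inv) ≫ e.inv.app _) ≫ _ = _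
        rw [Category.assoc]
        erw [h6]
        exact Category.comp_id _
      rw [h4]
      refine h1.trans ?_
      refine (congrArg (· ≫ (Ψ.iterationFunctorObjSuccIso o ho).inv)
        (bigSuccStruct_toSucc Φ (mem o))).trans ?_
      refine (Category.assoc _ _ _).trans (congrArg ((mem o).getIso.inv ≫ ·) ?_)
      exact Category.assoc _ _ _
    have h5 : e.hom.app o = (mem o).getIso.hom := rfl
    rw [h3, h5, Iso.hom_inv_id_assoc, y.map_comp, Category.assoc]
    simp

end Iteration


/-! ### Factorisation systems and convergence of chains -/

section Convergence

variable {E M : MorphismProperty C}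

namespace IsOrthogonalFactorizationSystem

variable (h : IsOrthogonalFactorizationSystem E M)
include h

/-- A cardinality argument: if `u ≠ v`, the copower of `e` under `A` by a large enough set `S` is
again an `E`-map, hence one of the set of representatives, yet it has a distinct map to `Z` for
every subset of `S`. Cowellpoweredness thus makes `E`-maps epimorphisms. -/
lemma left_hom_ext {A B Z : C} [HasColimits C] (hE : IsCowellpowered E) {e : A ⟶ B} (he : E e)
    {u v : B ⟶ Z} (huv : e ≫ u = e ≫ v) : u = v := by
  classical
  by_contra hne
  obtain ⟨I, r, hr⟩ := hE A
  -- `S` contains all maps to `Z` out of all representative `E`-quotients of `A`, so injecting `Set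
  -- S` into it contradicts Cantor's theorem.
  let S : Type w := Σ i, ((r i).right ⟶ Z)
  let P : C := widePushout A (fun _ : S => B) (fun _ => e)
  let b : A ⟶ P := WidePushout.head _
  -- Factor `b`; the lifts of the separate copies of `e` assemble to a section of the `M`-part, so
  -- `b` is a retract of its own `E`-part.
  have hb : E b := by
    obtain ⟨fac⟩ := h.hasFactorization.nonempty_mapFactorizationData b
    have hl : ∀ s : S, ∃ j : B ⟶ fac.Z, e ≫ j = fac.i ∧ j ≫ fac.p = WidePushout.ι (fun _ : S => e) s :=
      fun s => (h.unique_lift e fac.p fac.i (WidePushout.ι (fun _ : S => e) s) he fac.hp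
        (by rw [fac.fac]; exact (WidePushout.arrow_ι (fun _ : S => e) s).symm)).exists
    choose j hj hj' using hl
    let n : P ⟶ fac.Z := WidePushout.desc fac.i j hj
    have hn : b ≫ n = fac.i := WidePushout.head_desc _ _ _ _
    have hn' : n ≫ fac.p = 𝟙 P := by
      refine WidePushout.hom_ext _ _ _ (fun s => ?_) ?_
      · rw [WidePushout.ι_desc_assoc, hj', Category.comp_id]
      · rw [WidePushout.head_desc_assoc, fac.fac, Category.comp_id]
    have := h.left_retracts
    exact E.of_retract (g := fac.i)
      { i := Arrow.homMk (𝟙 A) n (by simp [hn])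
        r := Arrow.homMk (𝟙 A) fac.p (by simp [b])
        retract := by ext <;> simp [hn'] } fac.hi
  obtain ⟨i, ⟨θ⟩⟩ := hr (Under.mk b) hb
  let d : Set S → (P ⟶ Z) := fun T =>
    WidePushout.desc (e ≫ u) (fun s => if s ∈ T then u else v) (fun s => by split_ifs <;> simp [huv])
  have hd : Function.Injective d := by
    intro T T' hT
    ext s
    have h1 : WidePushout.ι (fun _ : S => e) s ≫ d T = if s ∈ T then u else v :=
      WidePushout.ι_desc _ _ _ _ _
    have h2 : WidePushout.ι (fun _ : S => e) s ≫ d T' = if s ∈ T' then u else v :=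
      WidePushout.ι_desc _ _ _ _ _
    rw [hT, h2] at h1
    by_cases hs : s ∈ T <;> by_cases hs' : s ∈ T' <;> simp_all
  refine Function.cantor_injective (fun T : Set S => (⟨i, θ.inv.right ≫ d T⟩ : S)) fun T T' hT => ?_
  replace hT := sigma_mk_injective hT
  have : IsIso θ.inv.right := inferInstanceAs (IsIso ((Under.forget _).map θ.inv))
  exact hd ((cancel_epi _).1 hT)

lemma right_of_isIso_comp {A B D : C} {t : A ⟶ B} [IsIso t] {m : B ⟶ D} (hm : M m) :
    M (t ≫ m) := by
  have := h.right_retracts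
  exact M.of_retract (g := m)
    { i := Arrow.homMk t (𝟙 D) (by simp)
      r := Arrow.homMk (inv t) (𝟙 D) (by simp) } hm

/-- Factoring `m` and lifting its `E`-part against `m ≫ n` gives a retraction of that part;
uniqueness of lifts against `n` shows that it exhibits `m` as a retract of its `M`-part. -/
lemma right_cancel {A B D : C} {m : A ⟶ B} {n : B ⟶ D} (hmn : M (m ≫ n)) (hn : M n) : M m := by
  obtain ⟨fac⟩ := h.hasFactorization.nonempty_mapFactorizationData m
  obtain ⟨j, ⟨hj, hj'⟩, -⟩ := h.unique_lift fac.i (m ≫ n) (𝟙 A) (fac.p ≫ n) fac.hi hmn (by simp)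
  have := h.right_retracts
  have hj'' : j ≫ m = fac.p := (h.unique_lift fac.i n m (fac.p ≫ n) fac.hi hn (by simp)).unique
    ⟨by rw [reassoc_of% hj], by simpa using hj'⟩ ⟨fac.fac, rfl⟩
  exact M.of_retract (g := fac.p)
    { i := Arrow.homMk fac.i (𝟙 B) (by simp)
      r := Arrow.homMk j (𝟙 B) (by simp [hj''])
      retract := by ext <;> simp [hj] } fac.hp

/-- The images of a stage of a chain in the later stages stabilise. -/
lemma exists_stable_image [HasColimits C] (hE : IsCowellpowered E) (F : Ordinal.{w} ⥤ C)
    (γ : Ordinal.{w}) : ∃ (φ : Ordinal.{w}) (hφ : γ ≤ φ) (Q : C) (e : F.obj γ ⟶ Q) (m : Q ⟶ F.obj φ),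
      E e ∧ e ≫ m = F.map (homOfLE hφ) ∧ ∀ β (hβ : φ ≤ β), M (m ≫ F.map (homOfLE hβ)) := by
  obtain ⟨I, r, hr⟩ := hE (F.obj γ)
  have hfac := fun β => h.hasFactorization.nonempty_mapFactorizationData
    (F.map (homOfLE (le_max_left γ β)))
  let fac := fun β => (hfac β).some
  choose cls iso using fun β => hr (Under.mk (fac β).i) (fac β).hi
  -- Some isomorphism class of images occurs cofinally; otherwise the classes, being a small set,
  -- would all stop occurring before the supremum of their bounds. A class that never occurs gets
  -- the bound `0`.
  have hcof : ∃ φ, ∀ b, ∃ β, b ≤ β ∧ cls β = cls φ := by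
    by_contra! hcon
    have hb : ∀ i : I, ∃ b, ∀ β, b ≤ β → cls β ≠ i := by
      intro i
      by_cases hi : ∃ φ, cls φ = i
      · obtain ⟨φ, rfl⟩ := hi
        exact hcon φ
      · exact ⟨0, fun β _ hβ => hi ⟨β, hβ⟩⟩
    choose b hb using hb
    exact hb (cls (⨆ i, b i)) _ (le_ciSup (Ordinal.bddAbove_of_small) _) rfl
  obtain ⟨φ, hφ⟩ := hcof
  refine ⟨max γ φ, le_max_left _ _, (fac φ).Z, (fac φ).i, (fac φ).p, (fac φ).hi, (fac φ).fac, ?_⟩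
  have lift : ∀ {β β'} (hβ : max γ β ≤ max γ β'), ∃ t : (fac β).Z ⟶ (fac β').Z,
      (fac β).i ≫ t = (fac β').i ∧ t ≫ (fac β').p = (fac β).p ≫ F.map (homOfLE hβ) := by
    intro β β' hβ
    refine (h.unique_lift (fac β).i (fac β').p (fac β').i ((fac β).p ≫ F.map (homOfLE hβ))
      (fac β).hi (fac β').hp ?_).exists
    rw [(fac β').fac, (fac β).fac_assoc, ← F.map_comp]
    rfl
  intro β hβ
  obtain ⟨β, rfl⟩ : ∃ β₀, β = max γ β₀ := ⟨β, (max_eq_right ((le_max_left _ _).trans hβ)).symm⟩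
  -- The comparison `t` from the image at `φ` to that at `β` has an inverse, obtained by continuing
  -- to a later `β'` with the same image as `φ`. Both composites are identities since `E`-maps are
  -- epic.
  obtain ⟨β', hββ', hβ'⟩ := hφ (max γ β)
  obtain ⟨t, ht, ht'⟩ := lift hβ
  obtain ⟨t', ht₁, -⟩ := lift (hββ'.trans (le_max_right γ β'))
  obtain ⟨θ⟩ : Nonempty (Under.mk (fac β').i ≅ Under.mk (fac φ).i) := by
    obtain ⟨a⟩ := iso φ
    obtain ⟨a'⟩ := iso β'
    exact ⟨a' ≪≫ eqToIso (by rw [hβ']) ≪≫ a.symm⟩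
  have hθ : (fac β').i ≫ θ.hom.right = (fac φ).i := Under.w θ.hom
  have h1 : t ≫ t' ≫ θ.hom.right = 𝟙 _ := h.left_hom_ext hE (fac φ).hi (by
    rw [reassoc_of% ht, reassoc_of% ht₁, hθ, Category.comp_id])
  have h2 : (t' ≫ θ.hom.right) ≫ t = 𝟙 _ := h.left_hom_ext hE (fac β).hi (by
    rw [Category.assoc, reassoc_of% ht₁, reassoc_of% hθ, ht, Category.comp_id])
  have : IsIso t := ⟨_, h1, h2⟩
  rw [← ht']
  exact h.right_of_isIso_comp (fac β).hp

end IsOrthogonalFactorizationSystem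

end Convergence


/-! ### Stages at which a smooth chain converges on small objects -/

section Convergence

lemma isOrthogonalFactorizationSystem_isomorphisms :
    IsOrthogonalFactorizationSystem (MorphismProperty.isomorphisms C) ⊤ where
  left_retracts := inferInstance
  right_retracts := ⟨fun _ _ => trivial⟩
  unique_lift e m f g he _ hfg := by
    have : IsIso e := he
    exact ⟨inv e ≫ f, ⟨by simp, by simp [hfg]⟩, fun j hj => by simp [← hj.1]⟩
  hasFactorization := ⟨fun f => ⟨
    { Z := _
      i := 𝟙 _
      p := f
      fac := by simp
      hi := MorphismProperty.isomorphisms.infer_property _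
      hp := trivial }⟩⟩

lemma isCowellpowered_isomorphisms : IsCowellpowered (MorphismProperty.isomorphisms C) := by
  intro X
  refine ⟨PUnit, fun _ => Under.mk (𝟙 X), fun Y hY => ⟨⟨⟩, ?_⟩⟩
  have : IsIso Y.hom := hY
  exact ⟨Under.isoMk (asIso Y.hom).symm (by simp)⟩

variable [HasColimits C] {E M : MorphismProperty C}

/-- Chains converge on small objects: a smooth chain indexed by all ordinals has a limit stage
which the maps out of the members of a small family of small objects see as a filtered colimit. -/
structure IsConvergenceStage {ι : Type w} (A : ι → C) (F : Ordinal.{w} ⥤ C) (l : Ordinal.{w}) :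
    Prop where
  isSuccLimit : Order.IsSuccLimit l
  exists_fac (i : ι) (a : A i ⟶ F.obj l) : ∃ (β : Ordinal.{w}) (hβ : β < l) (b : A i ⟶ F.obj β),
    b ≫ F.map (homOfLE hβ.le) = a
  exists_eq (i : ι) (β : Ordinal.{w}) (hβ : β < l) (a b : A i ⟶ F.obj β) :
    a ≫ F.map (homOfLE hβ.le) = b ≫ F.map (homOfLE hβ.le) →
    ∃ (β' : Ordinal.{w}) (h : β ≤ β'), β' < l ∧ a ≫ F.map (homOfLE h) = b ≫ F.map (homOfLE h)

/-- There are arbitrarily filtered well-ordered sets. -/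
lemma exists_isFilteredOrd {ι : Type w} (α : ι → Cardinal.{w}) :
    ∃ (K : Type w) (_ : LinearOrder K) (_ : WellFoundedLT K), Nonempty K ∧
      ∀ i, IsFilteredOrd (α i) K := by
  -- A successor of an infinite cardinal is regular, so subsets of smaller cardinality are bounded;
  -- taking it above all `α i` serves the whole family at once.
  let c : Cardinal.{w} := max Cardinal.aleph0 (⨆ i, α i)
  let κ : Cardinal.{w} := Order.succ c
  have hκ : κ.IsRegular := Cardinal.isRegular_succ (le_max_left _ _)
  have : Fact κ.IsRegular := ⟨hκ⟩
  have hmax : NoMaxOrder κ.ord.ToType := Cardinal.noMaxOrder hκ.aleph0_le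
  refine ⟨κ.ord.ToType, inferInstance, inferInstance, ?_, fun i => ⟨hmax, fun S hS => ?_⟩⟩
  · exact IsCardinalFiltered.nonempty κ.ord.ToType κ
  · have hS' : HasCardinalLT S κ := by
      rw [hasCardinalLT_iff_cardinal_mk_lt]
      exact Order.lt_succ_of_le (hS.trans ((le_ciSup (Cardinal.bddAbove_of_small) i).trans
        (le_max_right _ _)))
    refine ⟨IsCardinalFiltered.max (fun s : S => s.1) hS', fun s hs => ?_⟩
    exact leOfHom (IsCardinalFiltered.toMax (fun s : S => s.1) hS' ⟨s, hs⟩)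

/-- Smallness applies only to chains of `M`-maps, so the chain is replaced by the stable images `Q`
of a suitable subsequence. These form a chain of `M`-maps with the same colimit `F.obj l`, and each
`Q` maps back into a stage of `F` below `l`. -/
lemma IsOrthogonalFactorizationSystem.exists_isConvergenceStage
    (h : IsOrthogonalFactorizationSystem E M) (hE : IsCowellpowered E) {ι : Type w} (A : ι → C)
    (hA : ∀ i, ∃ α : Cardinal.{w}, IsSmallRel M α (coyoneda.obj (Opposite.op (A i))))
    (F : Ordinal.{w} ⥤ C) [F.IsWellOrderContinuous] : ∃ l, IsConvergenceStage A F l := by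
  choose φ hφ Q e m he hem hM using h.exists_stable_image hE F
  choose α hα using hA
  obtain ⟨K, _, _, ⟨k₀⟩, hK⟩ := exists_isFilteredOrd α
  by_cases hι : Nonempty ι
  swap
  · exact ⟨Ordinal.omega0, Ordinal.isSuccLimit_omega0, fun i => (hι ⟨i⟩).elim,
      fun i => (hι ⟨i⟩).elim⟩
  obtain ⟨i₀⟩ := hι
  have : NoMaxOrder K := (hK i₀).1
  -- Each `γ k` lies beyond the stages at which the images of all earlier `γ j` have stabilised, so
  -- `F` and `Q` interleave.
  let γ : K → Ordinal.{w} := WellFoundedLT.fix fun k prev => ⨆ j : Set.Iio k, Order.succ (φ (prev j.1 j.2))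
  have hγ : ∀ j k, j < k → φ (γ j) < γ k := by
    intro j k hjk
    have : γ k = ⨆ j : Set.Iio k, Order.succ (φ (γ j.1)) := WellFoundedLT.fix_eq _ _
    rw [this]
    exact (Order.lt_succ _).trans_le
      (le_ciSup (f := fun j : Set.Iio k => Order.succ (φ (γ j.1))) Ordinal.bddAbove_of_small ⟨j, hjk⟩)
  have hγ' : ∀ {j k}, j ≤ k → γ j ≤ γ k := by
    intro j k hjk
    obtain rfl | hjk := hjk.eq_or_lt
    · exact le_rfl
    · exact (hφ _).trans (hγ _ _ hjk).le
  let l : Ordinal.{w} := ⨆ k, γ k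
  have hγl : ∀ k, φ (γ k) < l := fun k => by
    obtain ⟨k', hk'⟩ := exists_gt k
    exact (hγ k k' hk').trans_le (le_ciSup (f := γ) Ordinal.bddAbove_of_small k')
  have hγl' : ∀ k, γ k < l := fun k => (hφ _).trans_lt (hγl k)
  have hl : ∀ β, β < l → ∃ k, β ≤ γ k := fun β hβ => by
    obtain ⟨k, hk⟩ := Ordinal.lt_iSup_iff.1 hβ
    exact ⟨k, hk.le⟩
  have hlim : Order.IsSuccLimit l := by
    refine ⟨fun hmin => (hγl' k₀).not_ge (hmin (hγl' k₀).le), Order.isSuccPrelimit_of_succ_lt ?_⟩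
    intro β hβ
    obtain ⟨k, hk⟩ := Ordinal.lt_iSup_iff.1 hβ
    exact (Order.succ_le_of_lt hk).trans_lt (hγl' k)
  let mm : ∀ k, Q (γ k) ⟶ F.obj l := fun k => m (γ k) ≫ F.map (homOfLE (hγl k).le)
  have hmm : ∀ k, M (mm k) := fun k => hM _ _ _
  have hemm : ∀ k, e (γ k) ≫ mm k = F.map (homOfLE (hγl' k).le) := fun k => by
    rw [reassoc_of% hem, chain_w]
  have ht : ∀ (j k : K) (hjk : j ≤ k), ∃ t : Q (γ j) ⟶ Q (γ k),
      e (γ j) ≫ t = F.map (homOfLE (hγ' hjk)) ≫ e (γ k) ∧ t ≫ mm k = mm j := fun j k hjk =>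
    (h.unique_lift (e (γ j)) (mm k) (F.map (homOfLE (hγ' hjk)) ≫ e (γ k)) (mm j) (he _) (hmm k)
      (by rw [Category.assoc, hemm, hemm, chain_w])).exists
  choose t ht ht' using ht
  let G : K ⥤ C :=
    { obj := fun k => Q (γ k)
      map := fun {j k} f => t _ _ (leOfHom f)
      map_id := fun k => h.left_hom_ext hE (he _) (by
        rw [ht, map_eq_id, Category.id_comp, Category.comp_id])
      map_comp := fun {i j k} f g => h.left_hom_ext hE (he _) (by
        rw [ht, reassoc_of% ht, ht, ← Category.assoc, chain_w]) }
  -- Both legs into `F.obj l` are `M`-maps, so cancellation puts the connecting map in `M`.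
  have hG : ∀ {a b : K} (f : a ⟶ b), M (G.map f) := fun {a b} f =>
    h.right_cancel (n := mm b) (by rw [ht']; exact hmm a) (hmm b)
  let cc : Cocone G :=
    { pt := F.obj l
      ι :=
        { app := mm
          naturality := fun j k f => (ht' _ _ (leOfHom f)).trans (Category.comp_id _).symm } }
  have hcc : Nonempty (IsColimit cc) := by
    -- A cocone on the images restricts along the maps `e` to a cocone on `F` below `l`, where the
    -- `γ k` are cofinal; epicness of `e` gives the factorisations.
    have hF := F.isColimitOfIsWellOrderContinuous l hlim
    have key : ∀ (c : Cocone G) {β : Ordinal.{w}} {j k : K} (hj : β ≤ γ j) (hk : β ≤ γ k),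
        F.map (homOfLE hj) ≫ e (γ j) ≫ c.ι.app j = F.map (homOfLE hk) ≫ e (γ k) ≫ c.ι.app k := by
      intro c β j k hj hk
      wlog hjk : j ≤ k generalizing j k
      · exact (this hk hj (le_of_not_ge hjk)).symm
      · rw [← c.w (homOfLE hjk)]
        change _ ≫ _ ≫ t _ _ _ ≫ _ = _
        rw [reassoc_of% ht, ← Category.assoc, chain_w]
    choose k hk using hl
    let d : ∀ c : Cocone G, F.obj l ⟶ c.pt := fun c => hF.desc
      ⟨c.pt, { app := fun β => F.map (homOfLE (hk β.1 β.2)) ≫ e _ ≫ c.ι.app _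
               naturality := fun β β' f => by
                  refine Eq.trans ?_ (Category.comp_id _).symm
                  rw [← Category.assoc]
                  refine (congrArg (· ≫ _) (chain_w F (leOfHom f) (hk β'.1 β'.2))).trans ?_
                  exact key c _ _ }⟩
    have hd : ∀ (c : Cocone G) (β : Ordinal.{w}) (hβ : β < l),
        F.map (homOfLE hβ.le) ≫ d c = F.map (homOfLE (hk β hβ)) ≫ e _ ≫ c.ι.app _ := fun c β hβ =>
      hF.fac _ (⟨β, hβ⟩ : Set.Iio l)
    refine ⟨⟨d, fun c j => h.left_hom_ext hE (he _) ?_, fun c n hn => hF.hom_ext fun β => ?_⟩⟩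
    · change e _ ≫ mm j ≫ _ = _
      rw [reassoc_of% hemm, hd c _ (hγl' j), key c (hk _ (hγl' j)) (le_refl (γ j)), map_eq_id,
        Category.id_comp]
    · refine Eq.trans ?_ (hd c β.1 β.2).symm
      change F.map (homOfLE (le_of_lt β.2)) ≫ n = _
      rw [← hn, ← chain_w F (hk β.1 β.2) (hγl' _).le, ← hemm, Category.assoc, Category.assoc]
  obtain ⟨hcc⟩ := hcc
  have hcoy := fun i => (hα i K (hK i) G hG).preserves hcc
  refine ⟨l, hlim, fun i a => ?_, fun i β hβ a b hab => ?_⟩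
  · obtain ⟨k, x, hx⟩ := Types.jointly_surjective_of_isColimit (hcoy i).some a
    refine ⟨φ (γ k), hγl k, x ≫ m (γ k), ?_⟩
    rw [Category.assoc]
    exact hx
  · obtain ⟨k, hk⟩ := hl β hβ
    have hk' : ∀ x : A i ⟶ F.obj β, (x ≫ F.map (homOfLE hk) ≫ e (γ k)) ≫ mm k =
        x ≫ F.map (homOfLE hβ.le) := fun x => by
      rw [Category.assoc, Category.assoc, hemm, chain_w]
    have : Nonempty K := ⟨k⟩
    obtain ⟨k', f, hf⟩ := (Types.FilteredColimit.isColimit_eq_iff' (hcoy i).some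
      (a ≫ F.map (homOfLE hk) ≫ e (γ k)) (b ≫ F.map (homOfLE hk) ≫ e (γ k))).1
      ((hk' a).trans (hab.trans (hk' b).symm))
    have hk'' : ∀ x : A i ⟶ F.obj β, (x ≫ F.map (homOfLE hk) ≫ e (γ k)) ≫ t _ _ (leOfHom f) ≫ m (γ k') =
        x ≫ F.map (homOfLE ((hk.trans (hγ' (leOfHom f))).trans (hφ _))) := fun x => by
      rw [Category.assoc, Category.assoc, reassoc_of% ht, hem, chain_w, chain_w]
    refine ⟨φ (γ k'), (hk.trans (hγ' (leOfHom f))).trans (hφ _), hγl k', ?_⟩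
    exact (hk'' a).symm.trans (((Category.assoc _ _ _).symm.trans (congrArg (· ≫ m (γ k')) hf)).trans
      ((Category.assoc _ _ _).trans (hk'' b)))

theorem HasSmallDomains.exists_isConvergenceStage {ι : Type w} {J : ι → Arrow C}
    (hJ : HasSmallDomains J) (F : Ordinal.{w} ⥤ C) [F.IsWellOrderContinuous] :
    ∃ l, IsConvergenceStage (fun i => (J i).left) F l := by
  obtain hJ | ⟨E, M, h, hE, hJ⟩ := hJ
  · refine isOrthogonalFactorizationSystem_isomorphisms.exists_isConvergenceStage
      isCowellpowered_isomorphisms _ (fun i => ?_) F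
    obtain ⟨α, hα⟩ := hJ i
    exact ⟨α, fun K _ _ hK G _ => (hα K hK).preservesColimit⟩
  · exact h.exists_isConvergenceStage hE _ hJ F

end Convergence


/-! ### The small object argument -/

section QuillenChain

open HomotopicalAlgebra

/-- The initial segment lives in universe `w + 1` but is equivalent to `o.ToType` in universe `w`.
-/
instance hasColimitsOfShape_Iio_ordinal [HasColimits C] (o : Ordinal.{w}) :
    HasColimitsOfShape (Set.Iio o) C :=
  hasColimitsOfShape_of_equivalence (Ordinal.ToType.mk (o := o)).equivalence.symm

instance hasColimitsOfShape_Iio_ordinal_over [HasColimits C] (o : Ordinal.{w}) (Y : C) :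
    HasColimitsOfShape (Set.Iio o) (Over Y) :=
  hasColimitsOfShape_of_equivalence (Ordinal.ToType.mk (o := o)).equivalence.symm

instance isWellOrderContinuous_comp_over_forget [HasColimits C] {Y : C}
    (G : Ordinal.{w} ⥤ Over Y) [G.IsWellOrderContinuous] :
    (G ⋙ Over.forget Y).IsWellOrderContinuous where
  nonempty_isColimit o ho :=
    ⟨isColimitOfPreserves (Over.forget Y) (G.isColimitOfIsWellOrderContinuous o ho)⟩

/-- The part of a smooth chain below a limit ordinal is a transfinite composition. -/
lemma transfiniteCompositions_of_isSuccLimit (W : MorphismProperty C) (F : Ordinal.{w} ⥤ C)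
    [F.IsWellOrderContinuous] (hF : ∀ o, W (F.map (homOfLE (Order.le_succ o)))) {l : Ordinal.{w}}
    (hl : Order.IsSuccLimit l) {X : C} (i : X ≅ F.obj ⊥) :
    MorphismProperty.transfiniteCompositions.{w} W (i.hom ≫ F.map (homOfLE (bot_le : ⊥ ≤ l))) := by
  let f : l.ToType <i Ordinal.{w} :=
    PrincipalSeg.relIsoTrans (Ordinal.ToType.mk (o := l)).symm.toRelIsoLT (Set.principalSegIio l)
  let _ : SuccOrder l.ToType := SuccOrder.ofLinearWellFoundedLT _
  have : Nonempty l.ToType := ⟨Ordinal.ToType.mk ⟨⊥, hl.bot_lt⟩⟩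
  let _ : OrderBot l.ToType := WellFoundedLT.toOrderBot _
  -- Stated with an equation for `b` because `f` preserves successors only up to propositional
  -- equality.
  have hsucc : ∀ {a b : Ordinal.{w}} (h : a ≤ b), b = Order.succ a → W (F.map (homOfLE h)) := by
    rintro a b h rfl
    exact hF a
  have hbot : f ⊥ = ⊥ := f.map_bot
  rw [MorphismProperty.transfiniteCompositions_iff]
  refine ⟨l.ToType, inferInstance, inferInstance, inferInstance, inferInstance, ⟨?_⟩⟩
  exact
    { F := f.monotone.functor ⋙ F
      isoBot := F.mapIso ⟨homOfLE hbot.le, homOfLE hbot.ge, rfl, rfl⟩ ≪≫ i.symm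
      isWellOrderContinuous :=
        inferInstanceAs ((f : l.ToType ≤i Ordinal).monotone.functor ⋙ F).IsWellOrderContinuous
      incl := (f.cocone F).ι
      isColimit := F.isColimitOfIsWellOrderContinuous' f hl
      fac := (Category.assoc _ _ _).trans (congrArg (i.hom ≫ ·) (chain_w F hbot.ge _))
      map_mem := fun j hj => hsucc _ <| by
        exact (((f : l.ToType ≤i Ordinal).apply_covBy_apply_iff.2
          (Order.covBy_succ_of_not_isMax hj)).succ_eq.symm) }

variable [HasColimits C] {ι : Type w} (J : ι → Arrow C)

/-- `λ¹_g` is obtained by attaching one cell for each lifting problem. -/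
noncomputable def stepAttachCells (g : Arrow C) :
    AttachCells.{w} (fun i => (J i).hom) (stepLam J g) where
  ι := Squares J g
  π := Sigma.fst
  cofan₁ := Cofan.mk _ (Sigma.ι fun x : Squares J g => (J x.1).left)
  cofan₂ := Cofan.mk _ (Sigma.ι fun x : Squares J g => (J x.1).right)
  isColimit₁ := coproductIsCoproduct _
  isColimit₂ := coproductIsCoproduct _
  m := Limits.Sigma.map fun x : Squares J g => (J x.1).hom
  hm _ := ι_colimMap _ _
  g₁ := Sigma.desc fun x : Squares J g => x.2.left
  g₂ := pushout.inr _ _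
  isPushout := IsPushout.of_hasPushout _ _

/-- The one-step factorisation over a fixed object, as a successor structure. -/
noncomputable def stepSuccStruct {X Y : C} (g : X ⟶ Y) : SmallObject.SuccStruct (Over Y) where
  X₀ := Over.mk g
  succ Z := Over.mk (Y := stepObj J (Arrow.mk Z.hom)) (stepRho J (Arrow.mk Z.hom))
  toSucc Z := Over.homMk (stepLam J (Arrow.mk Z.hom)) ((stepFact J).fac (Arrow.mk Z.hom))

variable {J} in
/-- The small object argument. -/
theorem HasSmallDomains.exists_fac (hJ : HasSmallDomains J) {X Y : C} (g : X ⟶ Y) :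
    ∃ (Z : C) (i : X ⟶ Z) (h : Z ⟶ Y), i ≫ h = g ∧
      MorphismProperty.transfiniteCompositions.{w} (MorphismProperty.coproducts.{w}
          (MorphismProperty.ofHoms fun i => (J i).hom)).pushouts i ∧
      Nonempty (LiftingData J (Arrow.mk h)) := by
  obtain ⟨G, _, ⟨e₀⟩, hG⟩ := exists_iteration (fun o => inferInstance) (stepSuccStruct J g)
  choose e he using hG
  obtain ⟨l, hl⟩ := hJ.exists_isConvergenceStage (G ⋙ Over.forget Y)
  let k : ∀ o, stepObj J (Arrow.mk (G.obj o).hom) ≅ (G.obj (Order.succ o)).left := fun o =>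
    (Over.forget Y).mapIso (e o).symm
  have he' : ∀ o, (G.map (homOfLE (Order.le_succ o))).left =
      stepLam J (Arrow.mk (G.obj o).hom) ≫ (k o).hom := fun o => congrArg (·.left) (he o)
  have hk : ∀ o, (k o).hom ≫ (G.obj (Order.succ o)).hom = stepRho J (Arrow.mk (G.obj o).hom) :=
    fun o => Over.w (e o).inv
  let k₀ : X ≅ (G.obj ⊥).left := (Over.forget Y).mapIso e₀.symm
  have hk₀ : k₀.hom ≫ (G.obj ⊥).hom = g := Over.w e₀.inv
  let W := (MorphismProperty.coproducts.{w} (MorphismProperty.ofHoms fun i => (J i).hom)).pushouts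
  have hW := transfiniteCompositions_of_isSuccLimit W (G ⋙ Over.forget Y) (fun o => ?_)
    hl.isSuccLimit k₀
  · refine ⟨(G.obj l).left, _, (G.obj l).hom, ?_, hW, ?_⟩
    · change (k₀.hom ≫ (G.map _).left) ≫ _ = _
      rw [Category.assoc, Over.w, hk₀]
    · have hfac : ∀ (i : ι) (a : (J i).left ⟶ (G.obj l).left), ∃ (β : Ordinal.{w}) (hβ : β < l)
          (b : (J i).left ⟶ (G.obj β).left), b ≫ (G.map (homOfLE hβ.le)).left = a := hl.exists_fac
      choose β hβ b hb using hfac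
      let y : ∀ (i : ι) (x : J i ⟶ Arrow.mk (G.obj l).hom),
          J i ⟶ Arrow.mk (G.obj (β i x.left)).hom := fun i x =>
        Arrow.homMk (b i x.left) x.right (by
          have h1 := hb i x.left
          have h2 := Arrow.w x
          have h3 := Over.w (G.map (homOfLE (hβ i x.left).le))
          change x.left ≫ (G.obj l).hom = _ at h2
          change b i x.left ≫ (G.obj _).hom = _
          rw [← h2, ← h3]
          exact (Category.assoc _ _ _).symm.trans (congrArg (· ≫ (G.obj l).hom) h1))
      have hβ' : ∀ i x, Order.succ (β i x) ≤ l := fun i x => Order.succ_le_of_lt (hβ i x)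
      -- A problem whose top edge factors through stage `β` is solved by the cell attached for it at
      -- the next stage, which is still at most the limit `l`.
      refine ⟨⟨fun i x => stepCell (y i x) ≫ (k _).hom ≫
        (G.map (homOfLE (hβ' i x.left))).left, fun i x => ?_, fun i x => ?_⟩⟩
      · rw [← Category.assoc, hom_stepCell, Category.assoc, ← reassoc_of% he',
          ← Over.comp_left, chain_w]
        exact hb i x.left
      · change (_ ≫ _ ≫ _) ≫ (G.obj l).hom = _
        rw [Category.assoc, Category.assoc, Over.w, hk, stepCell_rho]
        rfl
  · change W (G.map (homOfLE (Order.le_succ o))).left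
    rw [he']
    exact (W.cancel_right_of_respectsIso _ _).2 (stepAttachCells J _).pushouts_coproducts

end QuillenChain


/-! ### Chosen fillers -/

section Chosen

variable {ι : Type w} {J : ι → Arrow C}

/-- The lifting problem solved by a given map. -/
abbrev boundary {g : Arrow C} {i : ι} (c : (J i).right ⟶ g.left) : J i ⟶ g :=
  Arrow.homMk (f := J i) (g := g) ((J i).hom ≫ c) (c ≫ g.hom) (Category.assoc _ _ _)

namespace LiftingData

variable {g h : Arrow C}

/-- The chosen fillers of right lifting data. -/
def Chosen (δ : LiftingData J g) {i : ι} (c : (J i).right ⟶ g.left) : Prop :=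
  ∃ x, δ.fill i x = c

lemma chosen_fill (δ : LiftingData J g) {i : ι} (x : J i ⟶ g) : δ.Chosen (δ.fill i x) := ⟨x, rfl⟩

lemma boundary_fill (δ : LiftingData J g) {i : ι} (x : J i ⟶ g) : boundary (δ.fill i x) = x :=
  Arrow.hom_ext _ _ (δ.hom_fill i x) (δ.fill_hom i x)

lemma Chosen.eq {δ : LiftingData J g} {i : ι} {c c' : (J i).right ⟶ g.left} (hc : δ.Chosen c)
    (hc' : δ.Chosen c') (h : (J i).hom ≫ c = (J i).hom ≫ c') (h' : c ≫ g.hom = c' ≫ g.hom) :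
    c = c' := by
  obtain ⟨x, rfl⟩ := hc
  obtain ⟨x', rfl⟩ := hc'
  rw [δ.hom_fill, δ.hom_fill] at h
  rw [δ.fill_hom, δ.fill_hom] at h'
  rw [Arrow.hom_ext x x' h h']

/-- `u` sends the chosen fillers of `δ` to those of `δ'`. -/
def Marks (δ : LiftingData J g) (δ' : LiftingData J h) (u : g.left ⟶ h.left) : Prop :=
  ∀ (i : ι) (x : J i ⟶ g), δ'.Chosen (δ.fill i x ≫ u)

lemma Marks.chosen {δ : LiftingData J g} {δ' : LiftingData J h} {u : g.left ⟶ h.left}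
    (hu : δ.Marks δ' u) {i : ι} {c : (J i).right ⟶ g.left} (hc : δ.Chosen c) :
    δ'.Chosen (c ≫ u) := by
  obtain ⟨x, rfl⟩ := hc
  exact hu i x

lemma Marks.id (δ : LiftingData J g) : δ.Marks δ (𝟙 g.left) := fun i x => by
  rw [Category.comp_id]
  exact δ.chosen_fill x

lemma Marks.comp {k : Arrow C} {δ : LiftingData J g} {δ' : LiftingData J h} {δ'' : LiftingData J k}
    {u : g.left ⟶ h.left} {v : h.left ⟶ k.left} (hu : δ.Marks δ' u) (hv : δ'.Marks δ'' v) :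
    δ.Marks δ'' (u ≫ v) := fun i x => by
  rw [← Category.assoc]
  exact hv.chosen (hu i x)

/-- The lifting problem against `g` underlying one against `f ≫ g`. -/
abbrev lowerSq {X Y Z : C} {f : X ⟶ Y} {g : Y ⟶ Z} {i : ι} (x : J i ⟶ Arrow.mk (f ≫ g)) :
    J i ⟶ Arrow.mk g :=
  Arrow.homMk (f := J i) (g := Arrow.mk g) (x.left ≫ f) x.right
    ((Category.assoc _ _ _).trans (Arrow.w x))

/-- The lifting problem against `f` given by one against `f ≫ g` and a filler for `g`. -/
abbrev upperSq {X Y Z : C} {f : X ⟶ Y} {g : Y ⟶ Z} (δ : LiftingData J (Arrow.mk g)) {i : ι}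
    (x : J i ⟶ Arrow.mk (f ≫ g)) : J i ⟶ Arrow.mk f :=
  Arrow.homMk (f := J i) (g := Arrow.mk f) x.left (δ.fill i (lowerSq x))
    (δ.hom_fill i (lowerSq x)).symm

/-- The composite of maps with right lifting data. -/
abbrev comp {X Y Z : C} {f : X ⟶ Y} {g : Y ⟶ Z} (δ : LiftingData J (Arrow.mk f))
    (δ' : LiftingData J (Arrow.mk g)) : LiftingData J (Arrow.mk (f ≫ g)) where
  fill i x := δ.fill i (upperSq δ' x)
  hom_fill i x := δ.hom_fill i (upperSq δ' x)
  fill_hom i x := by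
    have h1 := δ.fill_hom i (upperSq δ' x)
    exact (Category.assoc _ _ _).symm.trans ((congrArg (· ≫ g) h1).trans (δ'.fill_hom i _))

/-- A chosen filler for the composite is found by first filling against `g` and then against `f`.
Since chosen fillers are determined by their boundary, being chosen at both levels is also
sufficient. -/
lemma comp_chosen {X Y Z : C} {f : X ⟶ Y} {g : Y ⟶ Z} {δ : LiftingData J (Arrow.mk f)}
    {δ' : LiftingData J (Arrow.mk g)} {i : ι} {c : (J i).right ⟶ X} :
    (δ.comp δ').Chosen c ↔ δ.Chosen c ∧ δ'.Chosen (c ≫ f) := by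
  constructor
  · rintro ⟨x, rfl⟩
    exact ⟨δ.chosen_fill (upperSq δ' x), ⟨lowerSq x, (δ.fill_hom i (upperSq δ' x)).symm⟩⟩
  · rintro ⟨⟨x, rfl⟩, ⟨y, hy⟩⟩
    have hx := δ.hom_fill i x
    have hx' := δ.fill_hom i x
    have hy' : lowerSq (boundary (g := Arrow.mk (f ≫ g)) (δ.fill i x)) = y := by
      refine Eq.trans (Arrow.hom_ext _ _ ?_ ?_) (δ'.boundary_fill y)
      · exact (Category.assoc _ _ _).trans (congrArg ((J i).hom ≫ ·) hy.symm)
      · exact (Category.assoc _ _ _).symm.trans (congrArg (· ≫ g) hy.symm)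
    refine ⟨boundary (g := Arrow.mk (f ≫ g)) (δ.fill i x), ?_⟩
    refine congrArg (δ.fill i) (Arrow.hom_ext (upperSq δ' _) x hx (Eq.trans ?_ hx'))
    change δ'.fill i (lowerSq _) = _
    rw [hy', hy]
    rfl

lemma marks_comp_iff {X Y Z : C} {f : X ⟶ Y} {g : Y ⟶ Z} {δ : LiftingData J (Arrow.mk f)}
    {δ' : LiftingData J (Arrow.mk g)} {δ'' : LiftingData J h} {u : h.left ⟶ X} :
    δ''.Marks (δ.comp δ') u ↔ δ''.Marks δ u ∧ δ''.Marks δ' (u ≫ f) := by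
  refine (forall₂_congr fun i x => comp_chosen).trans ?_
  refine ⟨fun H => ⟨fun i x => (H i x).1, fun i x => ?_⟩, fun H i x => ⟨H.1 i x, ?_⟩⟩
  · rw [← Category.assoc]
    exact (H i x).2
  · rw [Category.assoc]
    exact H.2 i x

end LiftingData

end Chosen

/-! ### Objects over a fixed object, with marked cells -/

/-- An object over `Y` with marked cells: maps into it from the codomains of the members of `J`. -/
structure MarkedOver {ι : Type w} (J : ι → Arrow C) (Y : C) where
  /-- the object over `Y` -/
  Z : Over Y
  /-- the marked cells -/
  cells (i : ι) : Set ((J i).right ⟶ Z.left)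

namespace MarkedOver

variable {ι : Type w} {J : ι → Arrow C} {Y : C}

/-- A morphism of objects over `Y` preserving the marked cells. -/
@[ext]
structure Hom (S T : MarkedOver J Y) where
  /-- the underlying morphism -/
  hom : S.Z ⟶ T.Z
  mem {i : ι} {c : (J i).right ⟶ S.Z.left} : c ∈ S.cells i → c ≫ hom.left ∈ T.cells i

instance : Category (MarkedOver J Y) where
  Hom := Hom
  id S := ⟨𝟙 _, fun h => by rw [Over.id_left, Category.comp_id]; exact h⟩
  comp a b := ⟨a.hom ≫ b.hom, fun h => by
    rw [Over.comp_left, ← Category.assoc]; exact b.mem (a.mem h)⟩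

variable (J Y) in
/-- Forgetting the marked cells. -/
abbrev forget : MarkedOver J Y ⥤ Over Y where
  obj S := S.Z
  map a := a.hom

lemma hom_ext {S T : MarkedOver J Y} {a b : S ⟶ T} (h : a.hom = b.hom) : a = b := Hom.ext h

section Colimits

variable {K : Type*} [Category* K] (F : K ⥤ MarkedOver J Y)

/-- A cocone with the images of the marked cells of the diagram as marked cells. -/
abbrev cocone (c : Cocone (F ⋙ forget J Y)) : Cocone F where
  pt := ⟨c.pt, fun i => {b | ∃ (k : K) (b₀ : (J i).right ⟶ (F.obj k).Z.left),
    b₀ ∈ (F.obj k).cells i ∧ b₀ ≫ (c.ι.app k).left = b}⟩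
  ι :=
    { app := fun k => ⟨c.ι.app k, fun {_ b₀} h => ⟨k, b₀, h, rfl⟩⟩
      naturality := fun _ _ f => hom_ext (c.ι.naturality f) }

/-- The colimit of a diagram of objects with marked cells. -/
def isColimitCocone {c : Cocone (F ⋙ forget J Y)} (hc : IsColimit c) : IsColimit (cocone F c) where
  desc s := ⟨hc.desc ((forget J Y).mapCocone s), by
    rintro i _ ⟨k, b₀, h, rfl⟩
    have := hc.fac ((forget J Y).mapCocone s) k
    rw [Category.assoc, ← Over.comp_left, this]
    exact (s.ι.app k).mem h⟩
  fac s k := hom_ext (hc.fac ((forget J Y).mapCocone s) k)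
  uniq s m hm := hom_ext (hc.uniq ((forget J Y).mapCocone s) m.hom fun k =>
    congrArg Hom.hom (hm k))

instance [HasColimit (F ⋙ forget J Y)] : HasColimit F :=
  ⟨⟨⟨_, isColimitCocone F (colimit.isColimit _)⟩⟩⟩

instance [HasColimit (F ⋙ forget J Y)] : PreservesColimit F (forget J Y) :=
  preservesColimit_of_preserves_colimit_cocone (isColimitCocone F (colimit.isColimit _))
    (colimit.isColimit _)

/-- Marking only the images of the cells of the diagram already gives a colimit, and the comparison
from any colimit to it is the identity on underlying objects. -/
lemma exists_cell_of_isColimit [HasColimit (F ⋙ forget J Y)] {c : Cocone F} (hc : IsColimit c)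
    {i : ι} {b : (J i).right ⟶ c.pt.Z.left} (hb : b ∈ c.pt.cells i) :
    ∃ (k : K) (b₀ : (J i).right ⟶ (F.obj k).Z.left),
      b₀ ∈ (F.obj k).cells i ∧ b₀ ≫ (c.ι.app k).hom.left = b := by
  have hc' := isColimitOfPreserves (forget J Y) hc
  let d := hc.desc (cocone F ((forget J Y).mapCocone c))
  have hd : d.hom = 𝟙 _ := hc'.hom_ext fun k =>
    (congrArg Hom.hom (hc.fac (cocone F ((forget J Y).mapCocone c)) k)).trans
      (Category.comp_id _).symm
  obtain ⟨k, b₀, h, h'⟩ := d.mem hb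
  refine ⟨k, b₀, h, h'.trans ?_⟩
  rw [hd]
  exact Category.comp_id _

end Colimits

section Successor

variable [HasColimits C] (T : MarkedOver J Y)

/-- The one-step extension of `T`, in which the marked cells of `T` are identified with the new
cells with the same boundary. -/
noncomputable abbrev quotObj : C :=
  coequalizer
    (Sigma.desc fun b : Σ i, T.cells i => b.2.1 ≫ stepLam J (Arrow.mk T.Z.hom))
    (Sigma.desc fun b : Σ i, T.cells i => stepCell (boundary (g := Arrow.mk T.Z.hom) b.2.1))

/-- The inclusion of `T` in its one-step extension. -/
noncomputable def quotLam : T.Z.left ⟶ T.quotObj :=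
  stepLam J (Arrow.mk T.Z.hom) ≫ coequalizer.π _ _

/-- The cells of the one-step extension of `T`. -/
noncomputable def quotCell {i : ι} (x : J i ⟶ Arrow.mk T.Z.hom) : (J i).right ⟶ T.quotObj :=
  stepCell x ≫ coequalizer.π _ _

lemma hom_quotCell {i : ι} (x : J i ⟶ Arrow.mk T.Z.hom) :
    (J i).hom ≫ T.quotCell x = x.left ≫ T.quotLam := by
  rw [quotCell, reassoc_of% hom_stepCell J x]
  rfl

lemma comp_quotLam {i : ι} {b : (J i).right ⟶ T.Z.left} (hb : b ∈ T.cells i) :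
    b ≫ T.quotLam = T.quotCell (boundary (g := Arrow.mk T.Z.hom) b) := by
  have h := congrArg (fun k => Sigma.ι _ (⟨i, b, hb⟩ : Σ i, T.cells i) ≫ k)
    (coequalizer.condition
      (Sigma.desc fun b : Σ i, T.cells i => b.2.1 ≫ stepLam J (Arrow.mk T.Z.hom))
      (Sigma.desc fun b : Σ i, T.cells i => stepCell (boundary (g := Arrow.mk T.Z.hom) b.2.1)))
  dsimp only at h
  rw [← Category.assoc, ← Category.assoc, Sigma.ι_desc, Sigma.ι_desc, Category.assoc] at h
  exact h

lemma exists_quotDesc {Z : C} (a : T.Z.left ⟶ Z)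
    (b : ∀ (i : ι) (_ : J i ⟶ Arrow.mk T.Z.hom), (J i).right ⟶ Z)
    (h : ∀ (i : ι) (x : J i ⟶ Arrow.mk T.Z.hom), (J i).hom ≫ b i x = x.left ≫ a)
    (h' : ∀ (i : ι) (c : (J i).right ⟶ T.Z.left), c ∈ T.cells i →
      c ≫ a = b i (boundary (g := Arrow.mk T.Z.hom) c)) :
    ∃ d : T.quotObj ⟶ Z, T.quotLam ≫ d = a ∧ ∀ i x, T.quotCell x ≫ d = b i x := by
  refine ⟨coequalizer.desc (stepDesc J (g := Arrow.mk T.Z.hom) a b h) ?_, ?_, fun i x => ?_⟩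
  · refine Sigma.hom_ext _ _ fun c => ?_
    rw [← Category.assoc, ← Category.assoc, Sigma.ι_desc, Sigma.ι_desc, Category.assoc]
    refine (congrArg (c.2.1 ≫ ·) (stepLam_desc J (g := Arrow.mk T.Z.hom) a b h)).trans
      ((h' c.1 c.2.1 c.2.2).trans ?_)
    exact (stepCell_desc J (g := Arrow.mk T.Z.hom) a b h _).symm
  · rw [quotLam, Category.assoc, coequalizer.π_desc]
    exact stepLam_desc J (g := Arrow.mk T.Z.hom) a b h
  · rw [quotCell, Category.assoc, coequalizer.π_desc]
    exact stepCell_desc J (g := Arrow.mk T.Z.hom) a b h x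

lemma quot_hom_ext {Z : C} {a b : T.quotObj ⟶ Z} (h : T.quotLam ≫ a = T.quotLam ≫ b)
    (h' : ∀ i (x : J i ⟶ Arrow.mk T.Z.hom), T.quotCell x ≫ a = T.quotCell x ≫ b) : a = b := by
  refine coequalizer.hom_ext (step_hom_ext J ?_ fun i x => ?_)
  · rw [← Category.assoc, ← Category.assoc]
    exact h
  · rw [← Category.assoc, ← Category.assoc]
    exact h' i x

lemma exists_quotRho : ∃ r : T.quotObj ⟶ Y, T.quotLam ≫ r = T.Z.hom ∧
    ∀ i (x : J i ⟶ Arrow.mk T.Z.hom), T.quotCell x ≫ r = x.right :=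
  T.exists_quotDesc _ (fun _ x => x.right) (fun _ x => (Arrow.w x).symm) (fun _ _ _ => rfl)

/-- The structure map of the one-step extension. -/
noncomputable def quotRho : T.quotObj ⟶ Y := T.exists_quotRho.choose

lemma quotLam_rho : T.quotLam ≫ T.quotRho = T.Z.hom := T.exists_quotRho.choose_spec.1

lemma quotCell_rho {i : ι} (x : J i ⟶ Arrow.mk T.Z.hom) : T.quotCell x ≫ T.quotRho = x.right :=
  T.exists_quotRho.choose_spec.2 i x

/-- The one-step extension, with the new cells as marked cells. -/
noncomputable abbrev quot : MarkedOver J Y where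
  Z := Over.mk T.quotRho
  cells i := {b | ∃ x : J i ⟶ Arrow.mk T.Z.hom, T.quotCell x = b}

/-- The inclusion of `T` in its one-step extension, as a morphism. -/
noncomputable abbrev toQuot : T ⟶ T.quot :=
  ⟨Over.homMk T.quotLam T.quotLam_rho, fun hc => ⟨_, (T.comp_quotLam hc).symm⟩⟩

/-- One-step extension as a successor structure. -/
noncomputable abbrev succStruct (J : ι → Arrow C) {X : C} (g : X ⟶ Y) :
    SmallObject.SuccStruct (MarkedOver J Y) where
  X₀ := ⟨Over.mk g, fun _ => ∅⟩
  succ := quot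
  toSucc := toQuot

end Successor

end MarkedOver


/-! ### The universal property of the chain of marked extensions -/

namespace MarkedOver

variable {ι : Type w} {J : ι → Arrow C} {Y : C}

lemma comp_hom_left {S T U : MarkedOver J Y} (a : S ⟶ T) (b : T ⟶ U) :
    (a ≫ b).hom.left = a.hom.left ≫ b.hom.left := rfl

/-- `u` lies over `v` and sends the marked cells to chosen fillers. -/
structure IsGood (T : MarkedOver J Y) {h : Arrow C} (ε : LiftingData J h) (v : Y ⟶ h.right)
    (u : T.Z.left ⟶ h.left) : Prop where
  w : u ≫ h.hom = T.Z.hom ≫ v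
  mem {i : ι} {c : (J i).right ⟶ T.Z.left} : c ∈ T.cells i → ε.Chosen (c ≫ u)

variable {h : Arrow C} {ε : LiftingData J h} {v : Y ⟶ h.right}

lemma IsGood.comp {S T : MarkedOver J Y} (a : S ⟶ T) {u : T.Z.left ⟶ h.left}
    (hu : T.IsGood ε v u) : S.IsGood ε v (a.hom.left ≫ u) where
  w := by rw [Category.assoc, hu.w, ← Over.w a.hom, Category.assoc]
  mem hc := by
    rw [← Category.assoc]
    exact hu.mem (a.mem hc)

section Quot

variable [HasColimits C] {T : MarkedOver J Y}

/-- New cells go to the chosen fillers of `ε`. This respects the identification of old marked cells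
with new ones because `u` already sends the old ones to chosen fillers, and these are determined by
their boundary. -/
lemma IsGood.exists_quot {u : T.Z.left ⟶ h.left} (hu : T.IsGood ε v u) :
    ∃ d : T.quotObj ⟶ h.left, T.quot.IsGood ε v d ∧ T.quotLam ≫ d = u := by
  let U : Arrow.mk T.Z.hom ⟶ h := Arrow.homMk (f := Arrow.mk T.Z.hom) (g := h) u v hu.w
  obtain ⟨d, hd, hd'⟩ := T.exists_quotDesc u (fun i x => ε.fill i (x ≫ U))
    (fun i x => ε.hom_fill i (x ≫ U)) (fun i c hc => by
      let b : J i ⟶ Arrow.mk T.Z.hom := boundary (g := Arrow.mk T.Z.hom) c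
      refine (hu.mem hc).eq (ε.chosen_fill (b ≫ U))
        ((Category.assoc _ _ _).symm.trans (ε.hom_fill i (b ≫ U)).symm) ?_
      rw [Category.assoc, hu.w]
      exact (Category.assoc _ _ _).symm.trans (ε.fill_hom i (b ≫ U)).symm)
  refine ⟨d, ⟨T.quot_hom_ext ?_ fun i x => ?_, ?_⟩, hd⟩
  · rw [reassoc_of% hd, hu.w]
    exact (congrArg (· ≫ v) T.quotLam_rho.symm).trans (Category.assoc _ _ _)
  · rw [reassoc_of% hd', ε.fill_hom]
    exact (congrArg (· ≫ v) (T.quotCell_rho x).symm).trans (Category.assoc _ _ _)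
  · rintro i _ ⟨x, rfl⟩
    rw [hd']
    exact ε.chosen_fill _

lemma IsGood.quot_ext {u u' : T.quotObj ⟶ h.left} (hu : T.quot.IsGood ε v u)
    (hu' : T.quot.IsGood ε v u') (w : T.quotLam ≫ u = T.quotLam ≫ u') : u = u' := by
  refine T.quot_hom_ext w fun i x => (hu.mem ⟨x, rfl⟩).eq (hu'.mem ⟨x, rfl⟩) ?_ ?_
  · rw [← Category.assoc, ← Category.assoc, T.hom_quotCell, Category.assoc, Category.assoc, w]
  · rw [Category.assoc, Category.assoc, hu.w, hu'.w]

end Quot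

section Chain

variable [HasColimits C] {G : Ordinal.{w} ⥤ MarkedOver J Y} [G.IsWellOrderContinuous]

lemma exists_cell_of_isSuccLimit {o : Ordinal.{w}} (ho : Order.IsSuccLimit o) {i : ι}
    {b : (J i).right ⟶ (G.obj o).Z.left} (hb : b ∈ (G.obj o).cells i) :
    ∃ (β : Ordinal.{w}) (hβ : β < o) (b₀ : (J i).right ⟶ (G.obj β).Z.left),
      b₀ ∈ (G.obj β).cells i ∧ b₀ ≫ (G.map (homOfLE hβ.le)).hom.left = b := by
  obtain ⟨β, b₀, h, h'⟩ := exists_cell_of_isColimit _ (G.isColimitOfIsWellOrderContinuous o ho) hb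
  exact ⟨β.1, β.2, b₀, h, h'⟩

instance : (G ⋙ forget J Y ⋙ Over.forget Y).IsWellOrderContinuous where
  nonempty_isColimit o ho := ⟨isColimitOfPreserves (forget J Y ⋙ Over.forget Y)
    (G.isColimitOfIsWellOrderContinuous o ho)⟩

/-- Maps preserving the marked cells extend uniquely along the free chain. -/
lemma existsUnique_isGood {X : C} (k₀ : X ≅ (G.obj ⊥).Z.left)
    (hk₀ : ∀ i, (G.obj ⊥).cells i = ∅)
    (e : ∀ o, G.obj (Order.succ o) ≅ (G.obj o).quot)
    (he : ∀ o, G.map (homOfLE (Order.le_succ o)) = (G.obj o).toQuot ≫ (e o).inv)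
    (a : X ⟶ h.left) (ha : a ≫ h.hom = k₀.hom ≫ (G.obj ⊥).Z.hom ≫ v) (o : Ordinal.{w}) :
    ∃! u : (G.obj o).Z.left ⟶ h.left, (G.obj o).IsGood ε v u ∧
      k₀.hom ≫ (G.map (homOfLE bot_le)).hom.left ≫ u = a := by
  have hle : ∀ {x y z : Ordinal.{w}} (p : x ≤ y) (q : y ≤ z),
      (G.map (homOfLE p)).hom.left ≫ (G.map (homOfLE q)).hom.left =
        (G.map (homOfLE (p.trans q))).hom.left := fun p q => by
    rw [← comp_hom_left, chain_w]
  induction o using SuccOrder.limitRecOn with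
  | isMin o ho =>
    obtain rfl := ho.eq_bot
    have h1 : (G.map (homOfLE (bot_le : (⊥ : Ordinal.{w}) ≤ ⊥))).hom.left = 𝟙 _ := by
      rw [map_eq_id]
      rfl
    rw [h1]
    refine ⟨k₀.inv ≫ a, ⟨⟨?_, fun {i c} hc => ?_⟩, ?_⟩, fun u hu => ?_⟩
    · rw [Category.assoc, ha, Iso.inv_hom_id_assoc]
    · rw [hk₀ i] at hc
      exact hc.elim
    · rw [Category.id_comp, Iso.hom_inv_id_assoc]
    · rw [← hu.2, Category.id_comp, Iso.inv_hom_id_assoc]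
  | succ o _ ih =>
    obtain ⟨u, ⟨hu, hu'⟩, huniq⟩ := ih
    have hes : (G.map (homOfLE (Order.le_succ o))).hom.left =
      (G.obj o).quotLam ≫ (e o).inv.hom.left := congrArg (·.hom.left) (he o)
    have hei : (e o).inv.hom.left ≫ (e o).hom.hom.left = 𝟙 _ :=
      congrArg (·.hom.left) (e o).inv_hom_id
    have hei' : (e o).hom.hom.left ≫ (e o).inv.hom.left = 𝟙 _ :=
      congrArg (·.hom.left) (e o).hom_inv_id
    obtain ⟨d, hd, hd'⟩ := hu.exists_quot
    refine ⟨(e o).hom.hom.left ≫ d, ⟨hd.comp (e o).hom, ?_⟩, fun u' ⟨h1, h2⟩ => ?_⟩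
    · rw [← hle bot_le (Order.le_succ o), hes, ← hu', ← hd']
      simp only [Category.assoc, reassoc_of% hei]
    · have h3 : (G.obj o).quotLam ≫ (e o).inv.hom.left ≫ u' = u := by
        rw [← Category.assoc, ← hes]
        refine huniq _ ⟨h1.comp _, ?_⟩
        rw [reassoc_of% hle]
        exact h2
      have h4 : (e o).inv.hom.left ≫ u' = d := (h1.comp (e o).inv).quot_ext hd (h3.trans hd'.symm)
      rw [← h4, reassoc_of% hei']
  | isSuccLimit o ho ih =>
    have hc := (G ⋙ forget J Y ⋙ Over.forget Y).isColimitOfIsWellOrderContinuous o ho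
    choose u hu huniq using fun β : Set.Iio o => ih β.1 β.2
    have hcomp : ∀ (β β' : Set.Iio o) (p : β.1 ≤ β'.1),
        (G.map (homOfLE p)).hom.left ≫ u β' = u β := fun β β' p => by
      refine huniq β _ ⟨(hu β').1.comp _, ?_⟩
      rw [reassoc_of% hle]
      exact (hu β').2
    let d : (G.obj o).Z.left ⟶ h.left := hc.desc ⟨h.left,
      { app := u
        naturality := fun β β' p => (hcomp β β' (leOfHom p)).trans (Category.comp_id _).symm }⟩
    have hd : ∀ β (hβ : β < o), (G.map (homOfLE hβ.le)).hom.left ≫ d = u ⟨β, hβ⟩ := fun β hβ =>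
      hc.fac _ (⟨β, hβ⟩ : Set.Iio o)
    refine ⟨d, ⟨⟨hc.hom_ext fun β => ?_, fun {i c} hc => ?_⟩, ?_⟩, fun d' ⟨h1, h2⟩ => ?_⟩
    · change (G.map (homOfLE β.2.le)).hom.left ≫ d ≫ h.hom =
        (G.map (homOfLE β.2.le)).hom.left ≫ (G.obj o).Z.hom ≫ v
      rw [reassoc_of% hd β.1 β.2, (hu β).1.w, ← Over.w (G.map (homOfLE β.2.le)).hom,
        Category.assoc]
    -- Marked cells at a limit come from below, where goodness is known.
    · obtain ⟨β, hβ, b₀, hb₀, rfl⟩ := exists_cell_of_isSuccLimit ho hc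
      rw [Category.assoc, hd]
      exact (hu ⟨β, hβ⟩).1.mem hb₀
    · rw [hd ⊥ ho.bot_lt, ← (hu ⟨⊥, ho.bot_lt⟩).2, map_eq_id]
      exact congrArg (k₀.hom ≫ ·) (Category.id_comp _).symm
    · refine hc.hom_ext fun β => ?_
      change (G.map (homOfLE β.2.le)).hom.left ≫ d' = (G.map (homOfLE β.2.le)).hom.left ≫ d
      rw [hd β.1 β.2]
      refine huniq β _ ⟨h1.comp _, ?_⟩
      rw [reassoc_of% hle]
      exact h2

end Chain

end MarkedOver

/-! ### Free right lifting data -/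

/-- Free right lifting data on a map over its codomain. -/
structure FreeLifting {ι : Type w} (J : ι → Arrow C) (g : Arrow C) where
  /-- the middle object -/
  obj : C
  /-- the unit -/
  lam : g.left ⟶ obj
  /-- the free map -/
  rho : obj ⟶ g.right
  fac : lam ≫ rho = g.hom
  /-- the free lifting data -/
  data : LiftingData J (Arrow.mk rho)
  existsUnique {h : Arrow C} (ε : LiftingData J h) (φ : g ⟶ h) :
    ∃! u : obj ⟶ h.left, (lam ≫ u = φ.left ∧ u ≫ h.hom = rho ≫ φ.right) ∧ data.Marks ε u

/-- The marked chain is stopped at a convergence stage `l`. There every lifting problem is the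
boundary of exactly one marked cell, so the marked cells are the chosen fillers of lifting data;
freeness is the universal property of the chain. -/
theorem HasSmallDomains.nonempty_freeLifting [HasColimits C] {ι : Type w} {J : ι → Arrow C}
    (hJ : HasSmallDomains J) (g : Arrow C) : Nonempty (FreeLifting J g) := by
  obtain ⟨G, _, ⟨e₀⟩, hG⟩ := exists_iteration
    (fun o => ⟨fun F => inferInstance⟩) (MarkedOver.succStruct J g.hom)
  choose e he using hG
  obtain ⟨l, hl⟩ := hJ.exists_isConvergenceStage
    (G ⋙ MarkedOver.forget J g.right ⋙ Over.forget g.right)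
  let k₀ : g.left ≅ (G.obj ⊥).Z.left :=
    (MarkedOver.forget J g.right ⋙ Over.forget g.right).mapIso e₀.symm
  have hk₀ : k₀.hom ≫ (G.obj ⊥).Z.hom = g.hom := Over.w e₀.inv.hom
  have hk₀' : ∀ i, (G.obj ⊥).cells i = ∅ := fun i =>
    Set.eq_empty_of_forall_notMem fun c hc => (e₀.hom.mem hc)
  have hle : ∀ {x y z : Ordinal.{w}} (p : x ≤ y) (q : y ≤ z),
      (G.map (homOfLE p)).hom.left ≫ (G.map (homOfLE q)).hom.left =
        (G.map (homOfLE (p.trans q))).hom.left := fun p q => by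
    rw [← MarkedOver.comp_hom_left, chain_w]
  let k : ∀ o, (G.obj o).quotObj ⟶ (G.obj (Order.succ o)).Z.left := fun o => (e o).inv.hom.left
  have hmap : ∀ o, (G.map (homOfLE (Order.le_succ o))).hom.left =
      (G.obj o).quotLam ≫ k o := fun o => congrArg (·.hom.left) (he o)
  have hw : ∀ o, k o ≫ (G.obj (Order.succ o)).Z.hom = (G.obj o).quotRho :=
    fun o => Over.w (e o).inv.hom
  have hcell : ∀ o {i} (y : J i ⟶ Arrow.mk (G.obj o).Z.hom),
      (G.obj o).quotCell y ≫ k o ∈ (G.obj (Order.succ o)).cells i :=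
    fun o i y => (e o).inv.mem ⟨y, rfl⟩
  have hfac : ∀ (i : ι) (a : (J i).left ⟶ (G.obj l).Z.left), ∃ (β : Ordinal.{w}) (hβ : β < l)
      (b : (J i).left ⟶ (G.obj β).Z.left), b ≫ (G.map (homOfLE hβ.le)).hom.left = a :=
    hl.exists_fac
  have heq : ∀ (i : ι) (β : Ordinal.{w}) (hβ : β < l) (a b : (J i).left ⟶ (G.obj β).Z.left),
      a ≫ (G.map (homOfLE hβ.le)).hom.left = b ≫ (G.map (homOfLE hβ.le)).hom.left →
      ∃ (β' : Ordinal.{w}) (h : β ≤ β'), β' < l ∧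
        a ≫ (G.map (homOfLE h)).hom.left = b ≫ (G.map (homOfLE h)).hom.left := hl.exists_eq
  -- Existence: the problem already lives at some stage below `l`, and its cell is attached at the
  -- next one.
  have hfill : ∀ (i : ι) (x : J i ⟶ Arrow.mk (G.obj l).Z.hom),
      ∃ c ∈ (G.obj l).cells i, boundary (g := Arrow.mk (G.obj l).Z.hom) c = x := by
    intro i x
    obtain ⟨β, hβ, b, hb⟩ := hfac i x.left
    have hβ' : Order.succ β ≤ l := Order.succ_le_of_lt hβ
    let y : J i ⟶ Arrow.mk (G.obj β).Z.hom :=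
      Arrow.homMk (f := J i) (g := Arrow.mk (G.obj β).Z.hom) b x.right (by
        have h2 : x.left ≫ (G.obj l).Z.hom = (J i).hom ≫ x.right := Arrow.w x
        have h3 := Over.w (G.map (homOfLE hβ.le)).hom
        refine Eq.trans ?_ h2
        rw [← hb, Category.assoc, h3]
        rfl)
    refine ⟨((G.obj β).quotCell y ≫ k β) ≫ (G.map (homOfLE hβ')).hom.left,
      (G.map (homOfLE hβ')).mem (hcell β y), Arrow.hom_ext _ _ ?_ ?_⟩
    · change (J i).hom ≫ (_ ≫ _) ≫ _ = _
      rw [← Category.assoc, ← Category.assoc, (G.obj β).hom_quotCell, Category.assoc,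
        Category.assoc, ← reassoc_of% hmap, hle]
      exact hb
    · change ((_ ≫ _) ≫ _) ≫ (G.obj l).Z.hom = _
      rw [Category.assoc, Category.assoc, Over.w, hw, (G.obj β).quotCell_rho]
      rfl
  -- Uniqueness: marked cells at `l` come from earlier stages, their boundaries already agree at
  -- some stage below `l`, and both cells are then identified with the same new cell one step later.
  have hinj : ∀ (i : ι) (c c' : (J i).right ⟶ (G.obj l).Z.left), c ∈ (G.obj l).cells i →
      c' ∈ (G.obj l).cells i → (J i).hom ≫ c = (J i).hom ≫ c' →
      c ≫ (G.obj l).Z.hom = c' ≫ (G.obj l).Z.hom → c = c' := by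
    have aux : ∀ (i : ι) (β : Ordinal.{w}) (hβ : β < l) (b b' : (J i).right ⟶ (G.obj β).Z.left),
        b ∈ (G.obj β).cells i → b' ∈ (G.obj β).cells i →
        (J i).hom ≫ b = (J i).hom ≫ b' → b ≫ (G.obj β).Z.hom = b' ≫ (G.obj β).Z.hom →
        b ≫ (G.map (homOfLE hβ.le)).hom.left = b' ≫ (G.map (homOfLE hβ.le)).hom.left := by
      intro i β hβ b b' hb hb' h1 h2
      have h3 : b ≫ (G.obj β).quotLam = b' ≫ (G.obj β).quotLam := by
        rw [(G.obj β).comp_quotLam hb, (G.obj β).comp_quotLam hb']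
        exact congrArg _ (Arrow.hom_ext _ _ h1 h2)
      rw [← hle (Order.le_succ β) (Order.succ_le_of_lt hβ), hmap, Category.assoc,
        reassoc_of% h3]
    intro i c c' hc hc' h1 h2
    obtain ⟨β, hβ, b, hb, rfl⟩ := MarkedOver.exists_cell_of_isSuccLimit hl.isSuccLimit hc
    obtain ⟨β', hβ', b', hb', rfl⟩ := MarkedOver.exists_cell_of_isSuccLimit hl.isSuccLimit hc'
    let γ := max β β'
    have hγ : γ < l := max_lt hβ hβ'
    obtain ⟨γ', p, hγ', h4⟩ := heq i γ hγ
      ((J i).hom ≫ b ≫ (G.map (homOfLE (le_max_left β β'))).hom.left)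
      ((J i).hom ≫ b' ≫ (G.map (homOfLE (le_max_right β β'))).hom.left) (by
        simp only [Category.assoc, hle]
        exact h1)
    have h5 := aux i γ' hγ' (b ≫ (G.map (homOfLE ((le_max_left β β').trans p))).hom.left)
      (b' ≫ (G.map (homOfLE ((le_max_right β β').trans p))).hom.left)
      ((G.map _).mem hb) ((G.map _).mem hb') (by
        simp only [Category.assoc, hle] at h4
        exact h4) (by
        rw [Category.assoc, Category.assoc, Over.w, Over.w]
        rw [Category.assoc, Category.assoc, Over.w, Over.w] at h2
        exact h2)
    simp only [Category.assoc, hle] at h5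
    exact h5
  choose c hc hcx using hfill
  let δ : LiftingData J (Arrow.mk (G.obj l).Z.hom) :=
    { fill := c
      hom_fill := fun i x => congrArg Arrow.Hom.left (hcx i x)
      fill_hom := fun i x => congrArg Arrow.Hom.right (hcx i x) }
  have hδ : ∀ {i : ι} {b : (J i).right ⟶ (G.obj l).Z.left},
      b ∈ (G.obj l).cells i ↔ δ.Chosen b := by
    intro i b
    constructor
    · intro hb
      refine ⟨boundary b, hinj i _ _ (hc _ _) hb (δ.hom_fill i (boundary b))
        (δ.fill_hom i (boundary b))⟩
    · rintro ⟨x, rfl⟩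
      exact hc i x
  refine ⟨⟨(G.obj l).Z.left, k₀.hom ≫ (G.map (homOfLE bot_le)).hom.left, (G.obj l).Z.hom, ?_, δ,
    fun {h} ε φ => ?_⟩⟩
  · rw [Category.assoc, Over.w]
    exact hk₀
  · obtain ⟨u, ⟨hu, hu'⟩, huniq⟩ := MarkedOver.existsUnique_isGood (ε := ε) (v := φ.right) k₀ hk₀'
      e he φ.left ((Arrow.w φ).trans (by rw [← reassoc_of% hk₀])) l
    refine ⟨u, ⟨⟨(Category.assoc _ _ _).trans hu', hu.w⟩, fun i x => hu.mem (hδ.2 ⟨x, rfl⟩)⟩,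
      fun u' ⟨⟨h1, h2⟩, h3⟩ => huniq u' ⟨⟨h2, fun hb => h3.chosen (hδ.1 hb)⟩,
        (Category.assoc _ _ _).symm.trans h1⟩⟩


/-! ### The natural weak factorisation system of free right lifting data -/

namespace FreeLifting

variable {ι : Type w} {J : ι → Arrow C}

section

variable {g : Arrow C} (F : FreeLifting J g) {Z W : C} {p : Z ⟶ W} (ε : LiftingData J (Arrow.mk p))
  (a : g.left ⟶ Z) (b : g.right ⟶ W)

lemma exists_desc (w : a ≫ p = g.hom ≫ b) : ∃ u : F.obj ⟶ Z, (F.lam ≫ u = a ∧ u ≫ p = F.rho ≫ b) ∧ F.data.Marks ε u :=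
  (F.existsUnique ε (Arrow.homMk (f := g) (g := Arrow.mk p) a b w)).exists

/-- The map out of free right lifting data induced by a map to right lifting data. -/
noncomputable def desc (w : a ≫ p = g.hom ≫ b) : F.obj ⟶ Z := (F.exists_desc ε a b w).choose

lemma lam_desc (w : a ≫ p = g.hom ≫ b) : F.lam ≫ F.desc ε a b w = a := (F.exists_desc ε a b w).choose_spec.1.1

lemma desc_hom (w : a ≫ p = g.hom ≫ b) : F.desc ε a b w ≫ p = F.rho ≫ b := (F.exists_desc ε a b w).choose_spec.1.2

lemma marks_desc (w : a ≫ p = g.hom ≫ b) : F.data.Marks ε (F.desc ε a b w) := (F.exists_desc ε a b w).choose_spec.2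

variable {ε b}

lemma hom_ext {u u' : F.obj ⟶ Z} (hu : F.data.Marks ε u) (hu' : F.data.Marks ε u')
    (hl : F.lam ≫ u = F.lam ≫ u') (hr : u ≫ p = F.rho ≫ b) (hr' : u' ≫ p = F.rho ≫ b) : u = u' := by
  have w : (F.lam ≫ u) ≫ p = g.hom ≫ b := by
    rw [Category.assoc, hr, ← Category.assoc, F.fac]
  exact (F.existsUnique ε (Arrow.homMk (f := g) (g := Arrow.mk p) (F.lam ≫ u) b w)).unique
    ⟨⟨rfl, hr⟩, hu⟩ ⟨⟨hl.symm, hr'⟩, hu'⟩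

/-- Maps into the second factor of a tower `Z → W → V` are compared through the composite lifting
data on `Z → V`. This is needed for equations into `E(λ_g)`, which lies over `E g` rather than over
the codomain of `g`. -/
lemma hom_ext_comp {V : C} {q : W ⟶ V} {ε' : LiftingData J (Arrow.mk q)} {b : g.right ⟶ V}
    {u u' : F.obj ⟶ Z} (hu : F.data.Marks ε u) (hu' : F.data.Marks ε u')
    (hp : u ≫ p = u' ≫ p) (hm : F.data.Marks ε' (u ≫ p)) (hl : F.lam ≫ u = F.lam ≫ u')
    (hr : (u ≫ p) ≫ q = F.rho ≫ b) : u = u' := by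
  have hr₁ : u ≫ p ≫ q = F.rho ≫ b := by rw [← Category.assoc, hr]
  have hr₂ : u' ≫ p ≫ q = F.rho ≫ b := by rw [← Category.assoc, ← hp, hr]
  exact F.hom_ext (p := p ≫ q) (ε := ε.comp ε') (LiftingData.marks_comp_iff.2 ⟨hu, hm⟩)
    (LiftingData.marks_comp_iff.2 ⟨hu', hp ▸ hm⟩) hl hr₁ hr₂

end

variable (F : ∀ g, FreeLifting J g)

section Fact

variable {g g' : Arrow C} (φ : g ⟶ g')

/-- The functorial action on free right lifting data. -/
noncomputable def map : (F g).obj ⟶ (F g').obj :=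
  (F g).desc (F g').data (φ.left ≫ (F g').lam) φ.right (by
    rw [Category.assoc, (F g').fac]
    exact Arrow.w φ)

lemma lam_map : (F g).lam ≫ map F φ = φ.left ≫ (F g').lam := lam_desc ..

lemma map_rho : map F φ ≫ (F g').rho = (F g).rho ≫ φ.right := desc_hom ..

lemma marks_map : (F g).data.Marks (F g').data (map F φ) := marks_desc _ _ _ _ _

/-- The functorial factorisation given by free right lifting data. -/
noncomputable abbrev fact : FunFact C where
  E :=
    { obj := fun g => (F g).obj
      map := map F
      map_id := fun g => (F g).hom_ext (b := 𝟙 g.right) (marks_map F _) (.id (F g).data)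
        ((lam_map F (𝟙 g)).trans ((Category.id_comp _).trans (Category.comp_id _).symm))
        (map_rho F (𝟙 g)) ((Category.id_comp _).trans (Category.comp_id _).symm)
      map_comp := fun φ ψ => (F _).hom_ext (marks_map F (φ ≫ ψ))
        ((marks_map F φ).comp (marks_map F ψ)) (by
          rw [lam_map, ← Category.assoc, lam_map, Category.assoc, lam_map]
          exact Category.assoc _ _ _) (map_rho F (φ ≫ ψ)) (by
          rw [Category.assoc, map_rho, ← Category.assoc, map_rho, Category.assoc]
          rfl) }
  lam g := (F g).lam
  rho g := (F g).rho
  lam_naturality φ := (lam_map F φ).symm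
  rho_naturality φ := map_rho F φ
  fac g := (F g).fac

end Fact

variable (g : Arrow C)

/-- The comultiplication. -/
noncomputable def sigma : (F g).obj ⟶ (F (Arrow.mk (F g).lam)).obj :=
  (F g).desc ((F (Arrow.mk (F g).lam)).data.comp (F g).data) (F (Arrow.mk (F g).lam)).lam
    (𝟙 g.right) (by
      rw [← Category.assoc, (F (Arrow.mk (F g).lam)).fac, Category.comp_id]
      exact (F g).fac)

lemma lam_sigma : (F g).lam ≫ sigma F g = (F (Arrow.mk (F g).lam)).lam := lam_desc ..

lemma marks_sigma : (F g).data.Marks (F (Arrow.mk (F g).lam)).data (sigma F g) :=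
  (LiftingData.marks_comp_iff.1 (marks_desc _ _ _ _ _)).1

lemma sigma_rho : sigma F g ≫ (F (Arrow.mk (F g).lam)).rho = 𝟙 (F g).obj := by
  refine (F g).hom_ext (b := 𝟙 g.right) (LiftingData.marks_comp_iff.1 (marks_desc _ _ _ _ _)).2
    (.id (F g).data) ?_ ?_ ((Category.id_comp _).trans (Category.comp_id _).symm)
  · rw [← Category.assoc, lam_sigma, (F (Arrow.mk (F g).lam)).fac]
    exact (Category.comp_id _).symm
  · rw [Category.assoc]
    exact desc_hom ..

/-- The multiplication. -/
noncomputable def pi : (F (Arrow.mk (F g).rho)).obj ⟶ (F g).obj :=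
  (F (Arrow.mk (F g).rho)).desc (F g).data (𝟙 (F g).obj) (𝟙 g.right)
    ((Category.id_comp _).trans (Category.comp_id _).symm)

lemma lam_pi : (F (Arrow.mk (F g).rho)).lam ≫ pi F g = 𝟙 (F g).obj := lam_desc ..

lemma pi_rho : pi F g ≫ (F g).rho = (F (Arrow.mk (F g).rho)).rho :=
  (desc_hom ..).trans (Category.comp_id _)

lemma marks_pi : (F (Arrow.mk (F g).rho)).data.Marks (F g).data (pi F g) := marks_desc _ _ _ _ _

/-- The comonad of free right lifting data. -/
noncomputable abbrev comonad : DomComonad C where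
  toFunFact := fact F
  sigma := sigma F
  sigma_naturality {g g'} φ := by
    let ψ : Arrow.mk (F g).lam ⟶ Arrow.mk (F g').lam := (fact F).L.map φ
    change map F φ ≫ sigma F g' = sigma F g ≫ map F ψ
    have h : (map F φ ≫ sigma F g') ≫ (F (Arrow.mk (F g').lam)).rho = map F φ := by
      rw [Category.assoc, sigma_rho, Category.comp_id]
    refine (F g).hom_ext_comp ((marks_map F φ).comp (marks_sigma F g'))
      ((marks_sigma F g).comp (marks_map F ψ)) (h.trans ?_) (by rw [h]; exact marks_map F φ) ?_
      (by rw [h]; exact map_rho F φ)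
    · rw [Category.assoc, map_rho, ← Category.assoc, sigma_rho]
      exact (Category.id_comp _).symm
    · rw [← Category.assoc, lam_map, Category.assoc, lam_sigma, ← Category.assoc, lam_sigma,
        lam_map]
      rfl
  lam_sigma := lam_sigma F
  sigma_rho := sigma_rho F
  sigma_counit g := by
    let ψ : Arrow.mk (F g).lam ⟶ g := (fact F).counit g
    change sigma F g ≫ map F ψ = 𝟙 (F g).obj
    refine (F g).hom_ext (b := 𝟙 g.right) ((marks_sigma F g).comp (marks_map F ψ))
      (.id (F g).data) ?_ ?_ ((Category.id_comp _).trans (Category.comp_id _).symm)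
    · rw [← Category.assoc, lam_sigma, lam_map, Category.comp_id]
      exact Category.id_comp _
    · rw [Category.assoc, map_rho, ← Category.assoc, sigma_rho, Category.id_comp, Category.comp_id]
      rfl
  coassoc g := by
    let g₁ := Arrow.mk (F g).lam
    let g₂ := Arrow.mk (F g₁).lam
    let ψ : g₁ ⟶ g₂ := Arrow.homMk (f := g₁) (g := g₂) (𝟙 g.left) (sigma F g)
      ((Category.id_comp _).trans (lam_sigma F g).symm)
    change sigma F g ≫ sigma F g₁ = sigma F g ≫ map F ψ
    have h : (sigma F g ≫ sigma F g₁) ≫ (F g₂).rho = sigma F g := by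
      rw [Category.assoc, sigma_rho, Category.comp_id]
    refine (F g).hom_ext_comp (ε' := (F g₁).data.comp (F g).data) (b := 𝟙 g.right)
      ((marks_sigma F g).comp (marks_sigma F g₁))
      ((marks_sigma F g).comp (marks_map F ψ)) (h.trans ?_) (by rw [h]; exact marks_desc _ _ _ _ _) ?_
      (by rw [h]; exact desc_hom ..)
    · rw [Category.assoc, map_rho, ← Category.assoc, sigma_rho]
      exact (Category.id_comp _).symm
    · rw [← Category.assoc, lam_sigma, lam_sigma, ← Category.assoc, lam_sigma, lam_map]
      exact (Category.id_comp _).symm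

/-- The natural weak factorisation system of free right lifting data. -/
noncomputable abbrev nwfs : NWFS C where
  toDomComonad := comonad F
  pi := pi F
  pi_naturality {g g'} φ := by
    let ψ : Arrow.mk (F g).rho ⟶ Arrow.mk (F g').rho := (fact F).R.map φ
    change map F ψ ≫ pi F g' = pi F g ≫ map F φ
    refine (F (Arrow.mk (F g).rho)).hom_ext (b := φ.right) ((marks_map F ψ).comp (marks_pi F g'))
      ((marks_pi F g).comp (marks_map F φ)) ?_ ?_ ?_
    · rw [← Category.assoc, lam_map, Category.assoc, lam_pi, ← Category.assoc, lam_pi]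
      exact (Category.comp_id _).trans (Category.id_comp _).symm
    · rw [Category.assoc, pi_rho, map_rho]
      rfl
    · rw [Category.assoc, map_rho, ← Category.assoc, pi_rho]
  pi_rho := pi_rho F
  lam_pi := lam_pi F
  unit_pi g := by
    let ψ : g ⟶ Arrow.mk (F g).rho := (fact F).unit g
    change map F ψ ≫ pi F g = 𝟙 (F g).obj
    refine (F g).hom_ext (b := 𝟙 g.right) ((marks_map F ψ).comp (marks_pi F g)) (.id (F g).data)
      ?_ ?_ ((Category.id_comp _).trans (Category.comp_id _).symm)
    · rw [← Category.assoc, lam_map, Category.assoc, lam_pi]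
      rfl
    · rw [Category.assoc, pi_rho, map_rho]
      rfl
  assoc g := by
    let g₁ := Arrow.mk (F g).rho
    let g₂ := Arrow.mk (F g₁).rho
    let ψ : g₂ ⟶ g₁ := Arrow.homMk (f := g₂) (g := g₁) (pi F g) (𝟙 g.right)
      ((pi_rho F g).trans (Category.comp_id _).symm)
    change map F ψ ≫ pi F g = pi F g₁ ≫ pi F g
    refine (F g₂).hom_ext (b := 𝟙 g.right) ((marks_map F ψ).comp (marks_pi F g))
      ((marks_pi F g₁).comp (marks_pi F g)) ?_ ?_ ?_
    · rw [← Category.assoc, lam_map, Category.assoc, lam_pi, ← Category.assoc, lam_pi]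
      exact (Category.comp_id _).trans (Category.id_comp _).symm
    · rw [Category.assoc, pi_rho, map_rho]
      rfl
    · rw [Category.assoc, pi_rho, pi_rho]
      exact (Category.comp_id _).symm
  distrib g := by
    let r := Arrow.mk (F g).rho
    let l := Arrow.mk (F g).lam
    let lr := Arrow.mk (F r).lam
    let rl := Arrow.mk (F l).rho
    let ψ : lr ⟶ rl := Arrow.homMk (f := lr) (g := rl) (sigma F g) (pi F g)
      ((sigma_rho F g).trans (lam_pi F g).symm)
    change pi F g ≫ sigma F g = sigma F r ≫ map F ψ ≫ pi F l
    have h : (pi F g ≫ sigma F g) ≫ (F l).rho = pi F g := by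
      rw [Category.assoc, sigma_rho, Category.comp_id]
    refine (F r).hom_ext_comp (b := 𝟙 g.right) ((marks_pi F g).comp (marks_sigma F g))
      ((marks_sigma F r).comp ((marks_map F ψ).comp (marks_pi F l))) (h.trans ?_)
      (by rw [h]; exact marks_pi F g) ?_ (by rw [h]; exact (pi_rho F g).trans (Category.comp_id _).symm)
    · rw [Category.assoc, Category.assoc, pi_rho, map_rho, ← Category.assoc, sigma_rho]
      exact (Category.id_comp _).symm
    · rw [← Category.assoc, lam_pi, ← Category.assoc, lam_sigma, ← Category.assoc, lam_map,
        Category.assoc, lam_pi]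
      exact (Category.id_comp _).trans (Category.comp_id _).symm

/-! ### The comparison with the one-step comonad -/

section OneStep

variable [HasColimits C]

/-- The cells of the one-step factorisation in the free right lifting data. -/
noncomputable def ofStep : stepObj J g ⟶ (F g).obj :=
  stepDesc J (F g).lam (fun i x => (F g).data.fill i (x ≫ (fact F).unit g))
    (fun i x => (F g).data.hom_fill i (x ≫ (fact F).unit g))

lemma stepLam_ofStep : stepLam J g ≫ ofStep F g = (F g).lam := stepLam_desc ..

lemma stepCell_ofStep {i : ι} (x : J i ⟶ g) :
    stepCell x ≫ ofStep F g = (F g).data.fill i (x ≫ (fact F).unit g) := stepCell_desc ..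

lemma ofStep_rho : ofStep F g ≫ (F g).rho = stepRho J g := by
  refine step_hom_ext J ?_ fun i x => ?_
  · rw [← Category.assoc, stepLam_ofStep, (F g).fac]
    exact ((stepFact J).fac g).symm
  · rw [← Category.assoc, stepCell_ofStep, stepCell_rho]
    exact ((F g).data.fill_hom i _).trans (Category.comp_id _)

/-- The canonical morphism from the one-step factorisation. -/
noncomputable abbrev stepHom : FunFactHom (oneStep J).toFunFact (nwfs F).toFunFact where
  app g := ofStep F g
  naturality {g g'} φ := by
    change stepMap J φ ≫ ofStep F g' = ofStep F g ≫ map F φ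
    refine step_hom_ext J ?_ fun i x => ?_
    · rw [← Category.assoc, stepLam_map, Category.assoc, stepLam_ofStep, ← Category.assoc,
        stepLam_ofStep, lam_map]
    · rw [← Category.assoc, stepCell_map, stepCell_ofStep, ← Category.assoc, stepCell_ofStep]
      -- Both sides are chosen fillers, so only their boundaries have to be compared.
      refine ((F g').data.chosen_fill _).eq (marks_map F φ i _) ?_ ?_
      · rw [← Category.assoc, (F g').data.hom_fill, (F g).data.hom_fill]
        change (x.left ≫ φ.left) ≫ (F g').lam = (x.left ≫ (F g).lam) ≫ map F φ
        rw [Category.assoc, Category.assoc, lam_map]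
      · refine ((F g').data.fill_hom i _).trans (Eq.trans ?_ (Category.assoc _ _ _).symm)
        refine Eq.trans ?_ (congrArg ((F g).data.fill i _ ≫ ·) (map_rho F φ)).symm
        refine Eq.trans ?_ (Category.assoc _ _ _)
        refine Eq.trans ?_ (congrArg (· ≫ φ.right) ((F g).data.fill_hom i _)).symm
        change (x.right ≫ φ.right) ≫ 𝟙 _ = (x.right ≫ 𝟙 _) ≫ φ.right
        rw [Category.comp_id, Category.comp_id]
  lam_app g := stepLam_ofStep F g
  app_rho g := ofStep_rho F g

lemma isComonadHom_stepHom :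
    IsComonadHom (F := oneStep J) (G := (nwfs F).toDomComonad) (stepHom F) := by
  intro g
  let l := Arrow.mk (stepLam J g)
  let l' := Arrow.mk (F g).lam
  let ψ : l ⟶ l' := (stepHom F).mapL g
  change ofStep F g ≫ sigma F g = stepSigma J g ≫ ofStep F l ≫ map F ψ
  refine step_hom_ext J ?_ fun i x => ?_
  · rw [← Category.assoc, stepLam_ofStep, lam_sigma, ← Category.assoc, stepLam_sigma,
      ← Category.assoc, stepLam_ofStep, lam_map]
    exact (Category.id_comp _).symm
  · rw [← Category.assoc, stepCell_ofStep, ← Category.assoc, stepCell_sigma, ← Category.assoc,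
      stepCell_ofStep]
    refine ((marks_sigma F g) i _).eq (marks_map F ψ i _) ?_ ?_
    · rw [← Category.assoc, ← Category.assoc, (F g).data.hom_fill, (F l).data.hom_fill]
      change (x.left ≫ (F g).lam) ≫ sigma F g = (x.left ≫ (F l).lam) ≫ map F ψ
      rw [Category.assoc, lam_sigma, Category.assoc, lam_map]
      exact congrArg (x.left ≫ ·) (Category.id_comp _).symm
    · refine (Category.assoc _ _ _).trans ((congrArg (_ ≫ ·) (sigma_rho F g)).trans ?_)
      refine Eq.trans ?_ (Category.assoc _ _ _).symm
      refine Eq.trans ?_ (congrArg ((F l).data.fill i _ ≫ ·) (map_rho F ψ)).symm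
      refine Eq.trans ?_ (Category.assoc _ _ _)
      refine Eq.trans ?_ (congrArg (· ≫ ψ.right) ((F l).data.fill_hom i _)).symm
      change _ ≫ 𝟙 _ = (stepCell x ≫ 𝟙 _) ≫ ofStep F g
      rw [Category.comp_id, Category.comp_id, stepCell_ofStep]

end OneStep

end FreeLifting


/-! ### `L`-maps are retracts of cell complexes -/

section Retract

variable {ι : Type w} {J : ι → Arrow C} {N : NWFS C} {α : ∀ i, LStr N.toDomComonad (J i)}
  {f : Arrow C} {Z : C} {i : f.left ⟶ Z} {h : Z ⟶ f.right}

/-- The retract argument, with identities on domains. -/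
lemma retracts_of_lift {W : MorphismProperty C} (hi : W i) (w : i ≫ h = f.hom) (t : f.right ⟶ Z)
    (ht : f.hom ≫ t = i) (ht' : t ≫ h = 𝟙 f.right) : W.retracts f.hom :=
  ⟨_, _, i,
    { i := Arrow.homMk (f := Arrow.mk f.hom) (g := Arrow.mk i) (𝟙 _) t
        ((Category.id_comp i).trans ht.symm)
      r := Arrow.homMk (f := Arrow.mk i) (g := Arrow.mk f.hom) (𝟙 _) h
        ((Category.id_comp f.hom).trans w.symm)
      retract := Arrow.hom_ext _ _ (Category.comp_id _) ht' }, hi⟩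

/-- The data `δ` underlie an algebra `p` on `h`, and the lift is `s` followed by `E` of the square
and then `p`. -/
lemma exists_lift_of_isCofibrantlyGeneratedBy (hN : N.IsCofibrantlyGeneratedBy J α)
    (s : LStr N.toDomComonad f) (δ : LiftingData J (Arrow.mk h)) (w : i ≫ h = f.hom) :
    ∃ t : f.right ⟶ Z, f.hom ≫ t = i ∧ t ≫ h = 𝟙 f.right := by
  obtain ⟨p, -⟩ := (hN.1 (Arrow.mk h)).2 δ
  let φ : f ⟶ Arrow.mk h := Arrow.homMk (f := f) (g := Arrow.mk h) i (𝟙 f.right)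
    (w.trans (Category.comp_id _).symm)
  refine ⟨s.s ≫ N.E.map φ ≫ p.p, ?_, ?_⟩
  · rw [← Category.assoc, s.hom_s, ← Category.assoc, ← N.lam_naturality, Category.assoc, p.lam_p]
    exact Category.comp_id _
  · rw [Category.assoc, Category.assoc]
    refine (congrArg (fun k => s.s ≫ N.E.map φ ≫ k) p.p_hom).trans ?_
    rw [N.rho_naturality, ← Category.assoc, s.s_rho]
    exact Category.comp_id _

/-- Initiality of `N` under the one-step comonad sends the structure on `f` to one for the n.w.f.s.
of free lifting data. Following it by the map that freeness induces from `δ` gives the lift, without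
any description of the algebras of `N`. -/
lemma exists_lift_of_isGeneratedBy [HasColimits C] (hJ : HasSmallDomains J)
    (hN : N.IsGeneratedBy J α) (s : LStr N.toDomComonad f) (δ : LiftingData J (Arrow.mk h))
    (w : i ≫ h = f.hom) : ∃ t : f.right ⟶ Z, f.hom ≫ t = i ∧ t ≫ h = 𝟙 f.right := by
  obtain ⟨χ, hχ, hu, -⟩ := hN
  let F : ∀ g, FreeLifting J g := fun g => (hJ.nonempty_freeLifting g).some
  obtain ⟨φ, ⟨hφ, -⟩, -⟩ := hu (FreeLifting.nwfs F) (FreeLifting.stepHom F)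
    (FreeLifting.isComonadHom_stepHom F)
  let s' : LStr (FreeLifting.nwfs F).toDomComonad f := LStr.map hφ s
  have w' : i ≫ h = f.hom ≫ 𝟙 f.right := w.trans (Category.comp_id _).symm
  have h1 : f.hom ≫ s'.s = (F f).lam := s'.hom_s
  have h2 : s'.s ≫ (F f).rho = 𝟙 f.right := s'.s_rho
  refine ⟨s'.s ≫ (F f).desc δ i (𝟙 f.right) w', ?_, ?_⟩
  · rw [← Category.assoc, h1, (F f).lam_desc]
  · rw [Category.assoc, (F f).desc_hom, Category.comp_id, h2]

theorem retracts_of_lStr [HasColimits C]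
    (hN : N.IsGeneratedBy J α ∨ N.IsCofibrantlyGeneratedBy J α) (hJ : HasSmallDomains J)
    (s : LStr N.toDomComonad f) :
    (MorphismProperty.transfiniteCompositions.{w} (MorphismProperty.coproducts.{w}
      (MorphismProperty.ofHoms fun i => (J i).hom)).pushouts).retracts f.hom := by
  obtain ⟨Z, i, h, w, hi, ⟨δ⟩⟩ := hJ.exists_fac f.hom
  obtain ⟨t, ht, ht'⟩ := hN.elim (fun hN => exists_lift_of_isGeneratedBy hJ hN s δ w)
    (fun hN => exists_lift_of_isCofibrantlyGeneratedBy hN s δ w)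
  exact retracts_of_lift hi w t ht ht'

end Retract

end NatWFS

theorem mainTheorem11 {C : Type u} [Category.{w} C] [HasColimits C]
    {ι : Type w} (J : ι → Arrow C)
    (N : NatWFS.NWFS C) (α : ∀ i, NatWFS.LStr N.toDomComonad (J i))
    (hN : N.IsGeneratedBy J α ∨ N.IsCofibrantlyGeneratedBy J α) :
    (∀ (K : Type w) [LinearOrder K] [OrderBot K] [SuccOrder K] [WellFoundedLT K]
        {X Y : C} (g : X ⟶ Y)
        (c : HomotopicalAlgebra.RelativeCellComplex.{w} (fun (_ : K) i => (J i).hom) g),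
        (∃! s : NatWFS.LStr N.toDomComonad (Arrow.mk g), NatWFS.IsCellStr α c s) ∧
        ∀ s : NatWFS.LStr N.toDomComonad (Arrow.mk g), NatWFS.IsCellStr α c s →
          ∀ (f : Arrow C) (D : NatWFS.ContractiblePair N.toDomComonad f s),
            ∃ r : NatWFS.LStr N.toDomComonad f,
              r.s = D.i.right ≫ s.s ≫ N.E.map D.p ∧ NatWFS.IsLHom r s D.i) ∧
    (NatWFS.HasSmallDomains J →
      ∀ f : Arrow C, Nonempty (NatWFS.LStr N.toDomComonad f) →
        (MorphismProperty.transfiniteCompositions.{w} (MorphismProperty.coproducts.{w}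
          (MorphismProperty.ofHoms fun i => (J i).hom)).pushouts).retracts f.hom) := by
  exact ⟨fun K _ _ _ _ X Y g c => ⟨NatWFS.existsUnique_isCellStr α c,
      fun s _ f D => NatWFS.exists_isLHom_of_contractiblePair D⟩,
    fun hJ f ⟨s⟩ => NatWFS.retracts_of_lStr hN hJ s⟩
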